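/- Let $\Omega$ be a compact metric space, $T:\Omega\to\Omega$ a homeomorphism, $a\in C(\Omega,\mathbb C)$ and $b\in C(\Omega,\mathbb R)$. For $\omega\in\Omega$ let $J_\omega$ be the bounded (self-adjoint) Jacobi operator on $\ell^2(\mathbb Z)$ given by $$(J_\omega\psi)(n)=\overline{a(T^{n-1}\omega)}\,\psi(n-1)+a(T^n\omega)\,\psi(n+1)+b(T^n\omega)\,\psi(n),$$ and let $\rho(J_\omega)$ be the set of $E\in\mathbb C$ for which $J_\omega-E$ has a bounded inverse. The function $a$ is allowed to vanish. For $E\in\mathbb C$ let $B^E:\Omega\to M(2,\mathbb C)$ be the Jacobi cocycle map $$B^E(\omega)=\begin{pmatrix}E-b(\omega)&-\overline{a(T^{-1}\omega)}\\ a(\omega)&0\end{pmatrix}.$$ For a continuous $B:\Omega\to M(2,\mathbb C)$ put $B_n(\omega)=B(T^{n-1}\omega)\cdots B(\omega)$ for $n\ge 1$. One says that $(T,B)$ has dominated splitting if there are continuous maps $E^s,E^u:\Omega\to\mathbb{CP}^1$, whose values are regarded as one-dimensional subspaces of $\mathbb C^2$, such that 1. $B(\omega)[E^s(\omega)]\subseteq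 E^s(T\omega)$ and $B(\omega)[E^u(\omega)]\subseteq E^u(T\omega)$ for all $\omega\in\Omega$; 2. there are an integer $N\ge 1$ and a real number $\lambda>1$ such that $\|B_N(\omega)\vec u\|>\lambda\|B_N(\omega)\vec s\|$ for all $\omega\in\Omega$ and all unit vectors $\vec u\in E^u(\omega)$ and $\vec s\in E^s(\omega)$, where $\|\cdot\|$ is the Euclidean norm. **Theorem.** Assume that $T$ is topologically transitive, and let $\omega_0\in\Omega$ be a point whose orbit $\{T^n\omega_0:n\in\mathbb Z\}$ is dense in $\Omega$. Then $$\rho(J_{\omega_0})=\{E\in\mathbb C:(T,B^E)\text{ has dominated splitting}\}.$$ -/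

import Mathlib

open scoped ENNReal

namespace JacobiJohnson

/-- The Hilbert space `ℓ²(ℤ)` of complex square-summable two-sided sequences. -/
abbrev L2Z : Type := lp (fun _ : ℤ => ℂ) 2

theorem weightedShift_memLp (c : ℤ → ℂ) (C : ℝ) (hc : ∀ n, ‖c n‖ ≤ C) (k : ℤ) (ψ : L2Z) :
    Memℓp (fun n : ℤ => c n * ψ (n + k)) 2 ∧
      ∑' n : ℤ, ‖c n * ψ (n + k)‖ ^ (2 : ℝ) ≤ (C * ‖ψ‖) ^ (2 : ℝ) := by
  have h2 : (0 : ℝ) < (2 : ℝ≥0∞).toReal := by norm_num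
  have hs := (lp.memℓp ψ).summable h2
  have hn := lp.norm_rpow_eq_tsum h2 ψ
  simp only [ENNReal.toReal_ofNat] at hs hn
  have hC : 0 ≤ C := (norm_nonneg _).trans (hc 0)
  have hs' : Summable fun n : ℤ => ‖ψ (n + k)‖ ^ (2 : ℝ) :=
    (Equiv.addRight k).summable_iff.2 hs
  have hb : ∀ n, ‖c n * ψ (n + k)‖ ^ (2 : ℝ) ≤ C ^ (2 : ℝ) * ‖ψ (n + k)‖ ^ (2 : ℝ) := by
    intro n
    rw [norm_mul, Real.mul_rpow (norm_nonneg _) (norm_nonneg _)]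
    gcongr
    exact hc n
  have hsum : Summable fun n : ℤ => ‖c n * ψ (n + k)‖ ^ (2 : ℝ) :=
    Summable.of_nonneg_of_le (fun n => by positivity) hb (hs'.mul_left _)
  refine ⟨memℓp_gen (by simpa using hsum), ?_⟩
  calc ∑' n : ℤ, ‖c n * ψ (n + k)‖ ^ (2 : ℝ)
      ≤ ∑' n : ℤ, C ^ (2 : ℝ) * ‖ψ (n + k)‖ ^ (2 : ℝ) := hsum.tsum_le_tsum hb (hs'.mul_left _)
    _ = C ^ (2 : ℝ) * ∑' n : ℤ, ‖ψ (n + k)‖ ^ (2 : ℝ) := tsum_mul_left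
    _ = C ^ (2 : ℝ) * ∑' n : ℤ, ‖ψ n‖ ^ (2 : ℝ) := congrArg _
        ((Equiv.addRight k).tsum_eq (fun n : ℤ => ‖ψ n‖ ^ (2 : ℝ)))
    _ = (C * ‖ψ‖) ^ (2 : ℝ) := by rw [← hn, Real.mul_rpow hC (norm_nonneg _)]

/-- The bounded operator `(S ψ)(n) = c(n) ψ(n + k)` on `ℓ²(ℤ)`, for a bounded weight `c`. -/
noncomputable def weightedShift (c : lp (fun _ : ℤ => ℂ) ∞) (k : ℤ) : L2Z →L[ℂ] L2Z :=
  LinearMap.mkContinuous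
    { toFun := fun ψ => ⟨fun n : ℤ => c n * ψ (n + k),
        (weightedShift_memLp c ‖c‖ (lp.norm_apply_le_norm ENNReal.top_ne_zero c) k ψ).1⟩
      map_add' := fun ψ φ => by
        ext n
        exact mul_add (c n) (ψ (n + k)) (φ (n + k))
      map_smul' := fun z ψ => by
        ext n
        exact mul_left_comm (c n) z (ψ (n + k)) }
    ‖c‖
    (fun ψ => lp.norm_le_of_tsum_le (by norm_num) (by positivity) (by
      simpa using
        (weightedShift_memLp c ‖c‖ (lp.norm_apply_le_norm ENNReal.top_ne_zero c) k ψ).2))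

@[simp]
theorem weightedShift_apply (c : lp (fun _ : ℤ => ℂ) ∞) (k : ℤ) (ψ : L2Z) (n : ℤ) :
    weightedShift c k ψ n = c n * ψ (n + k) := rfl

section Dynamics

variable {Ω : Type*} [MetricSpace Ω] [CompactSpace Ω]

/-- The bounded sequence `n ↦ f (T ^ n ω)` obtained by sampling a continuous function along an
orbit. -/
noncomputable def sample (T : Ω ≃ₜ Ω) (f : C(Ω, ℂ)) (ω : Ω) : lp (fun _ : ℤ => ℂ) ∞ :=
  ⟨fun n : ℤ => f ((T ^ n) ω),
    memℓp_infty ⟨‖f‖, by rintro _ ⟨n, rfl⟩; exact f.norm_coe_le_norm _⟩⟩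

@[simp]
theorem sample_apply (T : Ω ≃ₜ Ω) (f : C(Ω, ℂ)) (ω : Ω) (n : ℤ) :
    sample T f ω n = f ((T ^ n) ω) := rfl

/-- A real-valued continuous function viewed as a complex-valued one. -/
noncomputable def complexify (b : C(Ω, ℝ)) : C(Ω, ℂ) :=
  ⟨fun ω => (b ω : ℂ), by fun_prop⟩

/-- The function `ω ↦ conj (a (T⁻¹ ω))`. -/
noncomputable def conjBack (T : Ω ≃ₜ Ω) (a : C(Ω, ℂ)) : C(Ω, ℂ) :=
  ⟨fun ω => (starRingEnd ℂ) (a (T.symm ω)), by fun_prop⟩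

/-- The dynamically defined Jacobi operator `J_ω` on `ℓ²(ℤ)`; see `jacobiOperator_apply`. -/
noncomputable def jacobiOperator (T : Ω ≃ₜ Ω) (a : C(Ω, ℂ)) (b : C(Ω, ℝ)) (ω : Ω) :
    L2Z →L[ℂ] L2Z :=
  weightedShift (sample T (conjBack T a) ω) (-1) + weightedShift (sample T a ω) 1 +
    weightedShift (sample T (complexify b) ω) 0

/-- `(J_ω ψ)(n) = conj (a (T ^ (n-1) ω)) ψ(n-1) + a (T ^ n ω) ψ(n+1) + b (T ^ n ω) ψ(n)`. -/
theorem jacobiOperator_apply (T : Ω ≃ₜ Ω) (a : C(Ω, ℂ)) (b : C(Ω, ℝ)) (ω : Ω) (ψ : L2Z) (n : ℤ) :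
    jacobiOperator T a b ω ψ n =
      (starRingEnd ℂ) (a ((T ^ (n - 1)) ω)) * ψ (n - 1) + a ((T ^ n) ω) * ψ (n + 1) +
        (b ((T ^ n) ω) : ℂ) * ψ n := by
  have h : T.symm ((T ^ n) ω) = (T ^ (n - 1)) ω := by
    rw [show n - 1 = -1 + n by ring, zpow_add, zpow_neg_one]
    rfl
  simp [jacobiOperator, conjBack, complexify, h, sub_eq_add_neg]

/-- The Jacobi cocycle map
`B^E(ω) = [[E - b(ω), -conj (a (T⁻¹ ω))], [a(ω), 0]]`. -/
noncomputable def jacobiCocycle (T : Ω ≃ₜ Ω) (a : C(Ω, ℂ)) (b : C(Ω, ℝ)) (E : ℂ) :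
    C(Ω, Matrix (Fin 2) (Fin 2) ℂ) where
  toFun ω := !![E - (b ω : ℂ), -(starRingEnd ℂ) (a (T.symm ω)); a ω, 0]
  continuous_toFun := by
    refine continuous_matrix fun i j => ?_
    fin_cases i <;> fin_cases j <;> simp <;> fun_prop

/-- The iterates `B_n(ω) = B(T^{n-1} ω) ⋯ B(ω)`, with `B_0(ω) = I`. -/
noncomputable def iterate (T : Ω ≃ₜ Ω) (B : C(Ω, Matrix (Fin 2) (Fin 2) ℂ)) :
    ℕ → Ω → Matrix (Fin 2) (Fin 2) ℂ
  | 0, _ => 1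
  | n + 1, ω => B ((T ^ n) ω) * iterate T B n ω

end Dynamics

/-- The complex line in `ℂ²` given by a point of `ℂP¹ = ℂ ∪ {∞}`: the point `z ∈ ℂ` is the line
spanned by `(1, z)`, and `∞` is the line spanned by `(0, 1)`. -/
noncomputable def line : OnePoint ℂ → Submodule ℂ (EuclideanSpace ℂ (Fin 2))
  | none => Submodule.span ℂ {!₂[0, 1]}
  | some z => Submodule.span ℂ {!₂[1, z]}

@[simp]
theorem line_infty : line OnePoint.infty = Submodule.span ℂ {!₂[0, 1]} := rfl

@[simp]
theorem line_coe (z : ℂ) : line (z : OnePoint ℂ) = Submodule.span ℂ {!₂[1, z]} := rfl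

/-- `(T, B)` has dominated splitting: there are continuous maps `Es, Eu : Ω → ℂP¹` which are
invariant under `(T, B)` and such that `Eu` uniformly dominates `Es` at some step `N`. -/
def HasDominatedSplitting {Ω : Type*} [MetricSpace Ω] [CompactSpace Ω] (T : Ω ≃ₜ Ω)
    (B : C(Ω, Matrix (Fin 2) (Fin 2) ℂ)) : Prop :=
  ∃ Es Eu : Ω → OnePoint ℂ,
    (Continuous Es ∧ Continuous Eu) ∧
    (∀ ω, (line (Es ω)).map (B ω).toEuclideanLin ≤ line (Es (T ω)) ∧
      (line (Eu ω)).map (B ω).toEuclideanLin ≤ line (Eu (T ω))) ∧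
    ∃ N : ℕ, 0 < N ∧ ∃ Λ : ℝ, 1 < Λ ∧
      ∀ ω, ∀ u ∈ line (Eu ω), ∀ s ∈ line (Es ω), ‖u‖ = 1 → ‖s‖ = 1 →
        Λ * ‖(iterate T B N ω).toEuclideanLin s‖ < ‖(iterate T B N ω).toEuclideanLin u‖

end JacobiJohnson

/-! Both sides are compared with a lower bound `c * ‖ψ‖ ≤ ‖(J_ω - E) ψ‖`. Since `J_ω - E` is normal
for every complex `E`, such a bound at `ω₀` is equivalent to `E` lying in the resolvent set
(`mem_resolventSet_jacobiOperator_iff`). Zeros of `a` are handled by never dividing by it: a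
solution `ψ` of `(J_ω - E) ψ = 0` satisfies `B(T^n ω)(ψ n, ψ (n-1)) = a(T^n ω) (ψ (n+1), ψ n)`, and
`B` has determinant `a(ω) * conj (a (T⁻¹ ω))`.

Splitting implies bound. Split the data of a bounded solution along the two directions. Domination
together with the determinant identity shows that an unstable part would grow forwards and a stable
part backwards; a zero of `a` instead kills the unstable part before it and makes the solution
vanish after it. Hence bounded solutions are zero, at every `ω`
(`JacobiSplitting.eq_zero_of_bounded`). Compactness of `Ω` and of the unit ball of bounded sequences
in the product topology makes this quantitative in the sup norm (`exists_lt_norm_jacobiDiff`), and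
exponential weights turn the sup norm bound into an `ℓ²` bound (`mul_norm_le_of_weighted`,
`L2Z.norm_le_of_pointwise`).

Bound implies splitting. Covariance and strong continuity spread the bound from the dense orbit to
all of `Ω` with the same constant (`forall_mul_norm_le_of_dense`). The two directions are the data
at `0` of the `ℓ²` solutions on the right and on the left half-line. Each space has dimension at
most one by the Wronskian, and cutting with the resolvent writes every vector as a sum from the two
spaces, continuously in `ω` (`exists_continuous_splitting`), so both are continuous fields of lines.
Applied to truncated solutions, the lower bound controls a whole tail by its two boundary values.
This gives decay on the right and a lower bound for the cocycle on the left direction, and together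
domination (`exists_domination`). -/

namespace JacobiJohnson

/-! ### Normality of `J_ω - E` and the resolvent set as a lower bound. -/

section Operator

variable {Ω : Type*} [MetricSpace Ω] [CompactSpace Ω]

/-- The Jacobi difference expression `(J_ω - E) ψ` on arbitrary sequences `ψ : ℤ → ℂ`. -/
noncomputable def jacobiDiff (T : Ω ≃ₜ Ω) (a : C(Ω, ℂ)) (b : C(Ω, ℝ)) (E : ℂ) (ω : Ω)
    (ψ : ℤ → ℂ) (n : ℤ) : ℂ :=
  (starRingEnd ℂ) (a ((T ^ (n - 1)) ω)) * ψ (n - 1) + a ((T ^ n) ω) * ψ (n + 1) +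
    ((b ((T ^ n) ω) : ℂ) - E) * ψ n

/-- The bounded operator `J_ω - E`. -/
noncomputable def jacobiSub (T : Ω ≃ₜ Ω) (a : C(Ω, ℂ)) (b : C(Ω, ℝ)) (E : ℂ) (ω : Ω) :
    L2Z →L[ℂ] L2Z :=
  jacobiOperator T a b ω - algebraMap ℂ (L2Z →L[ℂ] L2Z) E

theorem jacobiSub_apply (T : Ω ≃ₜ Ω) (a : C(Ω, ℂ)) (b : C(Ω, ℝ)) (E : ℂ) (ω : Ω) (ψ : L2Z)
    (n : ℤ) : jacobiSub T a b E ω ψ n = jacobiDiff T a b E ω ψ n := by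
  have h : (algebraMap ℂ (L2Z →L[ℂ] L2Z) E) ψ = E • ψ := by
    simp [Algebra.algebraMap_eq_smul_one]
  have h2 : jacobiSub T a b E ω ψ n = jacobiOperator T a b ω ψ n - E * ψ n := by
    rw [jacobiSub, sub_apply, h]
    rfl
  rw [h2, jacobiOperator_apply, jacobiDiff]
  ring

theorem inner_weightedShift (c d : lp (fun _ : ℤ => ℂ) ∞) (k : ℤ)
    (h : ∀ n, d n = (starRingEnd ℂ) (c (n - k))) (ψ φ : L2Z) :
    inner ℂ (weightedShift c k ψ) φ = inner ℂ ψ (weightedShift d (-k) φ) := by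
  rw [lp.inner_eq_tsum, lp.inner_eq_tsum, ← (Equiv.addRight (-k)).tsum_eq]
  refine tsum_congr fun n => ?_
  have h1 : (Equiv.addRight (-k)) n = n + -k := rfl
  simp only [h1, weightedShift_apply, h, RCLike.inner_apply, map_mul, neg_add_cancel_right,
    sub_eq_add_neg]
  ring

theorem isSelfAdjoint_jacobiOperator (T : Ω ≃ₜ Ω) (a : C(Ω, ℂ)) (b : C(Ω, ℝ)) (ω : Ω) :
    IsSelfAdjoint (jacobiOperator T a b ω) := by
  rw [ContinuousLinearMap.isSelfAdjoint_iff_isSymmetric]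
  have hT : ∀ n : ℤ, T.symm ((T ^ n) ω) = (T ^ (n - 1)) ω := fun n => by
    rw [show n - 1 = -1 + n by ring, zpow_add, zpow_neg_one]
    rfl
  have h1 := inner_weightedShift (sample T (conjBack T a) ω) (sample T a ω) (-1) (fun n => by
    have := hT (n + 1)
    simp only [add_sub_cancel_right] at this
    simp [conjBack, this])
  have h2 := inner_weightedShift (sample T a ω) (sample T (conjBack T a) ω) 1 (fun n => by
    simp [conjBack, hT])
  have h3 := inner_weightedShift (sample T (complexify b) ω) (sample T (complexify b) ω) 0
    (fun n => by simp [complexify])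
  simp only [neg_neg, neg_zero] at h1 h2 h3
  intro ψ φ
  simp only [ContinuousLinearMap.coe_coe, jacobiOperator, add_apply,
    inner_add_left, inner_add_right, h1, h2, h3]
  ring

theorem isStarNormal_jacobiSub (T : Ω ≃ₜ Ω) (a : C(Ω, ℂ)) (b : C(Ω, ℝ)) (E : ℂ) (ω : Ω) :
    IsStarNormal (jacobiSub T a b E ω) := by
  have h := isSelfAdjoint_jacobiOperator T a b ω
  constructor
  rw [jacobiSub, star_sub, h.star_eq, ← algebraMap_star_comm]
  exact ((Commute.refl _).sub_right (Algebra.commute_algebraMap_right _ _)).sub_left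
    (Algebra.commute_algebraMap_left _ _)

end Operator

/-- For normal `A` the orthogonal complement of the range is `ker A`, which the bound makes trivial.
So the range is dense, and it is closed because `A` is antilipschitz. -/
theorem _root_.IsStarNormal.isUnit_of_bounded_below {H : Type*} [NormedAddCommGroup H]
    [InnerProductSpace ℂ H] [CompleteSpace H] {A : H →L[ℂ] H} (hA : IsStarNormal A) {c : ℝ}
    (hc : 0 < c) (h : ∀ x, c * ‖x‖ ≤ ‖A x‖) : IsUnit A := by
  have hanti : AntilipschitzWith (c⁻¹).toNNReal A :=
    A.antilipschitz_of_bound fun x => by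
      rw [Real.coe_toNNReal _ (inv_nonneg.2 hc.le), ← div_eq_inv_mul, le_div_iff₀' hc]
      exact h x
  rw [ContinuousLinearMap.isUnit_iff_bijective,
    ContinuousLinearMap.bijective_iff_dense_range_and_antilipschitz]
  refine ⟨?_, _, hanti⟩
  rw [Submodule.topologicalClosure_eq_top_iff, ContinuousLinearMap.IsStarNormal.orthogonal_range hA]
  exact LinearMap.ker_eq_bot.2 hanti.injective

theorem mem_resolventSet_jacobiOperator_iff {Ω : Type*} [MetricSpace Ω] [CompactSpace Ω]
    (T : Ω ≃ₜ Ω) (a : C(Ω, ℂ)) (b : C(Ω, ℝ)) (E : ℂ) (ω : Ω) :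
    E ∈ resolventSet ℂ (jacobiOperator T a b ω) ↔
      ∃ c : ℝ, 0 < c ∧ ∀ ψ, c * ‖ψ‖ ≤ ‖jacobiSub T a b E ω ψ‖ := by
  rw [spectrum.mem_resolventSet_iff, IsUnit.sub_iff]
  constructor
  · rintro h
    obtain ⟨_, K, hK⟩ := (ContinuousLinearMap.bijective_iff_dense_range_and_antilipschitz _).1
      (ContinuousLinearMap.isUnit_iff_bijective.1 h)
    obtain ⟨c, hc, h⟩ := antilipschitzWith_iff_exists_mul_le_norm.1 ⟨K, hK⟩
    exact ⟨c, hc, h⟩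
  · rintro ⟨c, hc, h⟩
    exact (isStarNormal_jacobiSub T a b E ω).isUnit_of_bounded_below hc h

/-! ### The cocycle acting on `ℂ²`, its determinant, and its action on solutions. -/

section Cocycle

variable {Ω : Type*} [MetricSpace Ω]

theorem zpow_apply_zpow_apply (T : Ω ≃ₜ Ω) (m n : ℤ) (ω : Ω) :
    (T ^ m) ((T ^ n) ω) = (T ^ (m + n)) ω := by
  rw [zpow_add]
  rfl

theorem apply_zpow_apply (T : Ω ≃ₜ Ω) (n : ℤ) (ω : Ω) : T ((T ^ n) ω) = (T ^ (n + 1)) ω := by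
  rw [add_comm, zpow_one_add]
  rfl

theorem symm_zpow_apply (T : Ω ≃ₜ Ω) (n : ℤ) (ω : Ω) :
    T.symm ((T ^ n) ω) = (T ^ (n - 1)) ω := by
  rw [T.symm_apply_eq, apply_zpow_apply, sub_add_cancel]

theorem jacobiDiff_zpow_apply (T : Ω ≃ₜ Ω) (a : C(Ω, ℂ)) (b : C(Ω, ℝ)) (E : ℂ) (ω : Ω)
    (ψ : ℤ → ℂ) (m n : ℤ) :
    jacobiDiff T a b E ((T ^ m) ω) (fun j => ψ (j + m)) n = jacobiDiff T a b E ω ψ (n + m) := by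
  simp only [jacobiDiff, zpow_apply_zpow_apply]
  rw [show n - 1 + m = n + m - 1 by ring, show n + 1 + m = n + m + 1 by ring]

/-- The Jacobi cocycle map `B^E(ω)` acting on `ℂ²`. -/
noncomputable def cocycleStep (T : Ω ≃ₜ Ω) (a : C(Ω, ℂ)) (b : C(Ω, ℝ)) (E : ℂ) (ω : Ω) :
    EuclideanSpace ℂ (Fin 2) →ₗ[ℂ] EuclideanSpace ℂ (Fin 2) :=
  (jacobiCocycle T a b E ω).toEuclideanLin

/-- The iterates `B^E_n(ω)` acting on `ℂ²`. -/
noncomputable def cocycleIter (T : Ω ≃ₜ Ω) (a : C(Ω, ℂ)) (b : C(Ω, ℝ)) (E : ℂ) (n : ℕ) (ω : Ω) :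
    EuclideanSpace ℂ (Fin 2) →ₗ[ℂ] EuclideanSpace ℂ (Fin 2) :=
  (iterate T (jacobiCocycle T a b E) n ω).toEuclideanLin

theorem cocycleStep_apply (T : Ω ≃ₜ Ω) (a : C(Ω, ℂ)) (b : C(Ω, ℝ)) (E : ℂ) (ω : Ω) (n : ℤ)
    (v : EuclideanSpace ℂ (Fin 2)) :
    cocycleStep T a b E ((T ^ n) ω) v =
      !₂[(E - b ((T ^ n) ω)) * v 0 - (starRingEnd ℂ) (a ((T ^ (n - 1)) ω)) * v 1,
        a ((T ^ n) ω) * v 0] := by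
  ext i
  fin_cases i <;>
    simp [cocycleStep, jacobiCocycle, Matrix.toLpLin_apply,
      dotProduct, Fin.sum_univ_two, symm_zpow_apply, sub_eq_add_neg]

theorem cocycleIter_zero (T : Ω ≃ₜ Ω) (a : C(Ω, ℂ)) (b : C(Ω, ℝ)) (E : ℂ) (ω : Ω)
    (v : EuclideanSpace ℂ (Fin 2)) : cocycleIter T a b E 0 ω v = v := by
  simp [cocycleIter, iterate]

theorem cocycleIter_succ (T : Ω ≃ₜ Ω) (a : C(Ω, ℂ)) (b : C(Ω, ℝ)) (E : ℂ) (n : ℕ) (ω : Ω)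
    (v : EuclideanSpace ℂ (Fin 2)) :
    cocycleIter T a b E (n + 1) ω v =
      cocycleStep T a b E ((T ^ (n : ℤ)) ω) (cocycleIter T a b E n ω v) := by
  simp [cocycleIter, cocycleStep, iterate, Matrix.toLpLin_apply]

theorem cocycleIter_add (T : Ω ≃ₜ Ω) (a : C(Ω, ℂ)) (b : C(Ω, ℝ)) (E : ℂ) (m n : ℕ) (ω : Ω)
    (v : EuclideanSpace ℂ (Fin 2)) :
    cocycleIter T a b E (n + m) ω v =
      cocycleIter T a b E m ((T ^ (n : ℤ)) ω) (cocycleIter T a b E n ω v) := by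
  induction m with
  | zero => simp [cocycleIter_zero]
  | succ m ih =>
    rw [← add_assoc, cocycleIter_succ, ih, cocycleIter_succ, zpow_apply_zpow_apply]
    push_cast
    rw [add_comm (m : ℤ)]

theorem cocycleIter_one (T : Ω ≃ₜ Ω) (a : C(Ω, ℂ)) (b : C(Ω, ℝ)) (E : ℂ) (ω : Ω)
    (v : EuclideanSpace ℂ (Fin 2)) : cocycleIter T a b E 1 ω v = cocycleStep T a b E ω v := by
  have := cocycleIter_succ T a b E 0 ω v
  simpa [cocycleIter_zero] using this

/-- The determinant of two vectors of `ℂ²`. -/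
def cross (v w : EuclideanSpace ℂ (Fin 2)) : ℂ := v 0 * w 1 - v 1 * w 0

theorem norm_cross_le (v w : EuclideanSpace ℂ (Fin 2)) : ‖cross v w‖ ≤ ‖v‖ * ‖w‖ := by
  have h := norm_inner_le_norm (𝕜 := ℂ) (!₂[-(starRingEnd ℂ) (v 1), (starRingEnd ℂ) (v 0)]) w
  have h1 : inner ℂ (!₂[-(starRingEnd ℂ) (v 1), (starRingEnd ℂ) (v 0)]) w = cross v w := by
    simp [PiLp.inner_apply, Fin.sum_univ_two, cross]
    ring
  have h2 : ‖(!₂[-(starRingEnd ℂ) (v 1), (starRingEnd ℂ) (v 0)] : EuclideanSpace ℂ (Fin 2))‖ =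
      ‖v‖ := by
    simp [EuclideanSpace.norm_eq, Fin.sum_univ_two, add_comm]
  rwa [h1, h2] at h

/-- Each step multiplies `cross` by the determinant of `B`. This identity links growth in one
direction to decay in the other without inverting `B`. -/
theorem cross_cocycleIter (T : Ω ≃ₜ Ω) (a : C(Ω, ℂ)) (b : C(Ω, ℝ)) (E : ℂ) (n : ℕ) (ω : Ω)
    (v w : EuclideanSpace ℂ (Fin 2)) :
    cross (cocycleIter T a b E n ω v) (cocycleIter T a b E n ω w) =
      (∏ j ∈ Finset.range n, a ((T ^ (j : ℤ)) ω) *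
        (starRingEnd ℂ) (a ((T ^ ((j : ℤ) - 1)) ω))) * cross v w := by
  induction n with
  | zero => simp [cocycleIter_zero]
  | succ n ih =>
    rw [Finset.prod_range_succ, mul_right_comm, ← ih]
    simp only [cocycleIter_succ, cocycleStep_apply, cross, Matrix.cons_val_zero,
      Matrix.cons_val_one]
    ring

/-- A solution of the difference equation is transported by the cocycle. -/
theorem cocycleStep_pair_eq (T : Ω ≃ₜ Ω) (a : C(Ω, ℂ)) (b : C(Ω, ℝ)) (E : ℂ) (ω : Ω) (n : ℤ)
    (ψ : ℤ → ℂ) (h : jacobiDiff T a b E ω ψ n = 0) :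
    cocycleStep T a b E ((T ^ n) ω) !₂[ψ n, ψ (n - 1)] =
      a ((T ^ n) ω) • !₂[ψ (n + 1), ψ n] := by
  rw [cocycleStep_apply]
  ext i
  fin_cases i
  · simp only [jacobiDiff] at h
    simp
    linear_combination -h
  · simp

theorem cocycleIter_pair_eq (T : Ω ≃ₜ Ω) (a : C(Ω, ℂ)) (b : C(Ω, ℝ)) (E : ℂ) (ω : Ω) (n : ℕ)
    (ψ : ℤ → ℂ) (h : ∀ n, 0 ≤ n → jacobiDiff T a b E ω ψ n = 0) :
    cocycleIter T a b E n ω !₂[ψ 0, ψ (-1)] =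
      (∏ j ∈ Finset.range n, a ((T ^ (j : ℤ)) ω)) • !₂[ψ n, ψ (n - 1)] := by
  induction n with
  | zero => simp [cocycleIter_zero]
  | succ n ih =>
    rw [cocycleIter_succ, ih, map_smul, cocycleStep_pair_eq _ _ _ _ _ _ _ (h n (by positivity)),
      Finset.prod_range_succ, smul_smul]
    simp

end Cocycle

open Filter Topology

/-! ### Incidence of vectors and points of `ℂP¹`. -/

section Line

theorem mem_line_infty_iff (v : EuclideanSpace ℂ (Fin 2)) :
    v ∈ line OnePoint.infty ↔ v 0 = 0 := by
  rw [line_infty, Submodule.mem_span_singleton]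
  constructor
  · rintro ⟨c, rfl⟩
    simp
  · intro h
    refine ⟨v 1, ?_⟩
    ext i
    fin_cases i <;> simp [h]

theorem mem_line_coe_iff (z : ℂ) (v : EuclideanSpace ℂ (Fin 2)) :
    v ∈ line (z : OnePoint ℂ) ↔ v 1 = z * v 0 := by
  rw [line_coe, Submodule.mem_span_singleton]
  constructor
  · rintro ⟨c, rfl⟩
    simp [mul_comm]
  · intro h
    refine ⟨v 0, ?_⟩
    ext i
    fin_cases i <;> simp [h, mul_comm]

theorem exists_mem_line_norm_eq_one (z : OnePoint ℂ) : ∃ v ∈ line z, ‖v‖ = 1 := by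
  have h : ∃ v ∈ line z, v ≠ 0 := by
    induction z using OnePoint.rec with
    | infty =>
      refine ⟨!₂[0, 1], (mem_line_infty_iff _).2 (by simp), fun h => ?_⟩
      simpa using congrArg (fun v : EuclideanSpace ℂ (Fin 2) => v 1) h
    | coe z =>
      refine ⟨!₂[1, z], (mem_line_coe_iff _ _).2 (by simp), fun h => ?_⟩
      simpa using congrArg (fun v : EuclideanSpace ℂ (Fin 2) => v 0) h
  obtain ⟨v, hv, h0⟩ := h
  refine ⟨((‖v‖⁻¹ : ℝ) : ℂ) • v, Submodule.smul_mem _ _ hv, ?_⟩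
  rw [norm_smul, Complex.norm_real, norm_inv, norm_norm, inv_mul_cancel₀ (norm_ne_zero_iff.2 h0)]

theorem cross_eq_zero_of_mem_line {z : OnePoint ℂ} {v w : EuclideanSpace ℂ (Fin 2)}
    (hv : v ∈ line z) (hw : w ∈ line z) : cross v w = 0 := by
  induction z using OnePoint.rec with
  | infty =>
    rw [mem_line_infty_iff] at hv hw
    simp [cross, hv, hw]
  | coe z =>
    rw [mem_line_coe_iff] at hv hw
    rw [cross, hv, hw]
    ring

theorem mem_line_of_cross_eq_zero {z : OnePoint ℂ} {v w : EuclideanSpace ℂ (Fin 2)}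
    (hv : v ∈ line z) (h0 : v ≠ 0) (h : cross v w = 0) : w ∈ line z := by
  induction z using OnePoint.rec with
  | infty =>
    rw [mem_line_infty_iff] at hv ⊢
    have h1 : v 1 ≠ 0 := fun h1 => h0 (by ext i; fin_cases i <;> simp [hv, h1])
    simpa [cross, hv, h1] using h
  | coe z =>
    rw [mem_line_coe_iff] at hv ⊢
    have h1 : v 0 ≠ 0 := fun h1 => h0 (by ext i; fin_cases i <;> simp [hv, h1])
    rw [cross, hv] at h
    refine mul_left_cancel₀ h1 ?_
    linear_combination h

theorem continuous_onePoint_elim_zero {f : ℂ → ℂ} (hf : Continuous f)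
    (h : ∀ z, ‖f z‖ ≤ ‖z‖⁻¹) : Continuous fun z : OnePoint ℂ => z.elim 0 f := by
  rw [OnePoint.continuous_iff]
  refine ⟨?_, hf⟩
  rw [coclosedCompact_eq_cocompact]
  exact squeeze_zero_norm h (tendsto_inv_atTop_zero.comp (tendsto_norm_cocompact_atTop (E := ℂ)))

/-- Membership of `v` in the line means `P v = v` for the orthogonal projection `P` onto it. The
entries `z / (1 + |z|²)` and `|z|² / (1 + |z|²)` of `P` extend continuously to `∞` with values `0`
and `1`. -/
theorem isClosed_setOf_mem_line :
    IsClosed {p : OnePoint ℂ × EuclideanSpace ℂ (Fin 2) | p.2 ∈ line p.1} := by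
  have hpos : ∀ z : ℂ, 0 < 1 + ‖z‖ ^ 2 := fun z => by positivity
  have hne : ∀ z : ℂ, (1 + (‖z‖ : ℂ) ^ 2) ≠ 0 := fun z => by exact_mod_cast (hpos z).ne'
  have hnorm : ∀ z : ℂ, ‖(1 + (‖z‖ : ℂ) ^ 2)‖ = 1 + ‖z‖ ^ 2 := fun z => by
    have : (1 + (‖z‖ : ℂ) ^ 2) = ((1 + ‖z‖ ^ 2 : ℝ) : ℂ) := by push_cast; rfl
    rw [this, Complex.norm_real, Real.norm_of_nonneg (hpos z).le]
  have hα : Continuous fun z : OnePoint ℂ => z.elim 0 fun z : ℂ => z / (1 + (‖z‖ : ℂ) ^ 2) := by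
    refine continuous_onePoint_elim_zero (by fun_prop (disch := exact hne _)) fun z => ?_
    rcases eq_or_ne z 0 with rfl | hz
    · simp
    · have hz : 0 < ‖z‖ := norm_pos_iff.2 hz
      rw [norm_div, hnorm, ← one_div, div_le_div_iff₀ (hpos z) hz]
      nlinarith
  have hβ : Continuous fun z : OnePoint ℂ => z.elim 1 fun z : ℂ =>
      (‖z‖ : ℂ) ^ 2 / (1 + (‖z‖ : ℂ) ^ 2) := by
    rw [OnePoint.continuous_iff]
    refine ⟨?_, by
      show Continuous fun z : ℂ => (‖z‖ : ℂ) ^ 2 / (1 + (‖z‖ : ℂ) ^ 2)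
      fun_prop (disch := exact hne _)⟩
    rw [coclosedCompact_eq_cocompact]
    refine tendsto_sub_nhds_zero_iff.1 (squeeze_zero_norm' (a := fun z : ℂ => ‖z‖⁻¹) ?_
      (tendsto_inv_atTop_zero.comp (tendsto_norm_cocompact_atTop (E := ℂ))))
    filter_upwards [(tendsto_norm_cocompact_atTop (E := ℂ)).eventually_gt_atTop 0] with z hz
    show ‖(‖z‖ : ℂ) ^ 2 / (1 + (‖z‖ : ℂ) ^ 2) - 1‖ ≤ _
    rw [div_sub_one (hne z), norm_div, hnorm, ← one_div, div_le_div_iff₀ (hpos z) hz]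
    simp
    nlinarith
  -- The two rows of `P v = v`: at `∞` the first carries the condition, at finite `z` the second
  -- does.
  have : {p : OnePoint ℂ × EuclideanSpace ℂ (Fin 2) | p.2 ∈ line p.1} =
      {p | (p.1.elim 1 fun z : ℂ => (‖z‖ : ℂ) ^ 2 / (1 + (‖z‖ : ℂ) ^ 2)) * p.2 0 =
        (starRingEnd ℂ) (p.1.elim 0 fun z : ℂ => z / (1 + (‖z‖ : ℂ) ^ 2)) * p.2 1} ∩
      {p | (p.1.elim 0 fun z : ℂ => z / (1 + (‖z‖ : ℂ) ^ 2)) * p.2 0 =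
        (1 - (p.1.elim 1 fun z : ℂ => (‖z‖ : ℂ) ^ 2 / (1 + (‖z‖ : ℂ) ^ 2))) * p.2 1} := by
    ext ⟨z, v⟩
    simp only [Set.mem_ofPred_eq, Set.mem_inter_iff]
    induction z using OnePoint.rec with
    | infty =>
      rw [mem_line_infty_iff]
      simp
    | coe z =>
      rw [mem_line_coe_iff]
      simp only [OnePoint.elim_some]
      have hz := hne z
      have hzz : z * (starRingEnd ℂ) z = (‖z‖ : ℂ) ^ 2 := Complex.mul_conj' z
      constructor
      · intro h
        rw [h]
        constructor
        · simp only [map_div₀, map_add, map_one, map_pow, Complex.conj_ofReal]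
          rw [← hzz]
          ring
        · field_simp
          ring
      · rintro ⟨-, h⟩
        field_simp at h
        linear_combination -h
  rw [this]
  have h1 : Continuous fun p : OnePoint ℂ × EuclideanSpace ℂ (Fin 2) => p.2 0 := by fun_prop
  have h2 : Continuous fun p : OnePoint ℂ × EuclideanSpace ℂ (Fin 2) => p.2 1 := by fun_prop
  have hα' := hα.comp (continuous_fst (X := OnePoint ℂ) (Y := EuclideanSpace ℂ (Fin 2)))
  have hβ' := hβ.comp (continuous_fst (X := OnePoint ℂ) (Y := EuclideanSpace ℂ (Fin 2)))
  exact (isClosed_eq (hβ'.mul h1) ((Complex.continuous_conj.comp hα').mul h2)).inter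
    (isClosed_eq (hα'.mul h1) ((continuous_const.sub hβ').mul h2))

end Line

/-! ### Elementary consequences of a dominated splitting: injectivity on the unstable line, angles,
decomposition. -/

section Splitting

variable {Ω : Type*} [MetricSpace Ω]

/-- The data of a dominated splitting for the Jacobi cocycle. -/
structure JacobiSplitting (T : Ω ≃ₜ Ω) (a : C(Ω, ℂ)) (b : C(Ω, ℝ)) (E : ℂ) where
  /-- the dominated direction -/
  stable : Ω → OnePoint ℂ
  /-- the dominating direction -/
  unstable : Ω → OnePoint ℂ
  continuous_stable : Continuous stable
  continuous_unstable : Continuous unstable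
  step_stable : ∀ ω, ∀ v ∈ line (stable ω), cocycleStep T a b E ω v ∈ line (stable (T ω))
  step_unstable : ∀ ω, ∀ v ∈ line (unstable ω), cocycleStep T a b E ω v ∈ line (unstable (T ω))
  /-- the number of steps after which the domination is visible -/
  steps : ℕ
  steps_pos : 0 < steps
  /-- the rate of domination -/
  rate : ℝ
  one_lt_rate : 1 < rate
  dominates : ∀ ω, ∀ u ∈ line (unstable ω), ∀ s ∈ line (stable ω), ‖u‖ = 1 → ‖s‖ = 1 →
    rate * ‖cocycleIter T a b E steps ω s‖ < ‖cocycleIter T a b E steps ω u‖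

theorem hasDominatedSplitting_jacobiCocycle_iff [CompactSpace Ω] (T : Ω ≃ₜ Ω) (a : C(Ω, ℂ))
    (b : C(Ω, ℝ)) (E : ℂ) :
    HasDominatedSplitting T (jacobiCocycle T a b E) ↔ Nonempty (JacobiSplitting T a b E) := by
  constructor
  · rintro ⟨Es, Eu, ⟨hs, hu⟩, hinv, N, hN, r, hr, h⟩
    exact ⟨⟨Es, Eu, hs, hu, fun ω v hv => (hinv ω).1 (Submodule.mem_map_of_mem hv),
      fun ω v hv => (hinv ω).2 (Submodule.mem_map_of_mem hv), N, hN, r, hr, h⟩⟩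
  · rintro ⟨D⟩
    refine ⟨D.stable, D.unstable, ⟨D.continuous_stable, D.continuous_unstable⟩,
      fun ω => ⟨?_, ?_⟩, D.steps, D.steps_pos, D.rate, D.one_lt_rate, D.dominates⟩
    · rintro _ ⟨v, hv, rfl⟩
      exact D.step_stable ω v hv
    · rintro _ ⟨v, hv, rfl⟩
      exact D.step_unstable ω v hv

namespace JacobiSplitting

variable {T : Ω ≃ₜ Ω} {a : C(Ω, ℂ)} {b : C(Ω, ℝ)} {E : ℂ} (D : JacobiSplitting T a b E)

theorem iter_stable (n : ℕ) (ω : Ω) {v : EuclideanSpace ℂ (Fin 2)} (hv : v ∈ line (D.stable ω)) :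
    cocycleIter T a b E n ω v ∈ line (D.stable ((T ^ (n : ℤ)) ω)) := by
  induction n with
  | zero => simpa [cocycleIter_zero] using hv
  | succ n ih =>
    rw [cocycleIter_succ, Nat.cast_succ, ← apply_zpow_apply]
    exact D.step_stable _ _ ih

theorem iter_unstable (n : ℕ) (ω : Ω) {v : EuclideanSpace ℂ (Fin 2)}
    (hv : v ∈ line (D.unstable ω)) :
    cocycleIter T a b E n ω v ∈ line (D.unstable ((T ^ (n : ℤ)) ω)) := by
  induction n with
  | zero => simpa [cocycleIter_zero] using hv
  | succ n ih =>
    rw [cocycleIter_succ, Nat.cast_succ, ← apply_zpow_apply]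
    exact D.step_unstable _ _ ih

/-- Domination is a strict inequality whose smaller side is nonnegative, so a noninvertible `B` is
still injective on the dominating line. -/
theorem norm_iter_pos {ω : Ω} {u : EuclideanSpace ℂ (Fin 2)} (hu : u ∈ line (D.unstable ω))
    (h0 : u ≠ 0) : cocycleIter T a b E D.steps ω u ≠ 0 := by
  obtain ⟨s, hs, hs1⟩ := exists_mem_line_norm_eq_one (D.stable ω)
  have hn := norm_ne_zero_iff.2 h0
  have h := D.dominates ω (((‖u‖⁻¹ : ℝ) : ℂ) • u) (Submodule.smul_mem _ _ hu) s hs (by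
    rw [norm_smul, Complex.norm_real, norm_inv, norm_norm, inv_mul_cancel₀ hn]) hs1
  intro h1
  rw [map_smul, h1, smul_zero, norm_zero] at h
  have := D.one_lt_rate
  have : 0 ≤ D.rate * ‖cocycleIter T a b E D.steps ω s‖ := by positivity
  linarith

theorem step_eq_zero {ω : Ω} {u : EuclideanSpace ℂ (Fin 2)} (hu : u ∈ line (D.unstable ω))
    (h : cocycleStep T a b E ω u = 0) : u = 0 := by
  by_contra h0
  refine D.norm_iter_pos hu h0 ?_
  obtain ⟨M, hM⟩ : ∃ M, D.steps = 1 + M := ⟨D.steps - 1, by have := D.steps_pos; omega⟩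
  rw [hM, cocycleIter_add, cocycleIter_one, h, map_zero]

theorem iter_eq_zero (n : ℕ) {ω : Ω} {u : EuclideanSpace ℂ (Fin 2)}
    (hu : u ∈ line (D.unstable ω)) (h : cocycleIter T a b E n ω u = 0) : u = 0 := by
  induction n with
  | zero => rwa [cocycleIter_zero] at h
  | succ n ih =>
    rw [cocycleIter_succ] at h
    exact ih (D.step_eq_zero (D.iter_unstable n ω hu) h)

theorem dominates_mul {ω : Ω} {u s : EuclideanSpace ℂ (Fin 2)} (hu : u ∈ line (D.unstable ω))
    (hs : s ∈ line (D.stable ω)) :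
    D.rate * ‖cocycleIter T a b E D.steps ω s‖ * ‖u‖ ≤
      ‖cocycleIter T a b E D.steps ω u‖ * ‖s‖ := by
  rcases eq_or_ne u 0 with rfl | hu0
  · simp
  rcases eq_or_ne s 0 with rfl | hs0
  · simp
  have hu1 := norm_pos_iff.2 hu0
  have hs1 := norm_pos_iff.2 hs0
  have h := D.dominates ω (((‖u‖⁻¹ : ℝ) : ℂ) • u) (Submodule.smul_mem _ _ hu)
    (((‖s‖⁻¹ : ℝ) : ℂ) • s) (Submodule.smul_mem _ _ hs)
    (by rw [norm_smul, Complex.norm_real, norm_inv, norm_norm, inv_mul_cancel₀ hu1.ne'])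
    (by rw [norm_smul, Complex.norm_real, norm_inv, norm_norm, inv_mul_cancel₀ hs1.ne'])
  rw [map_smul, map_smul, norm_smul, norm_smul, Complex.norm_real, Complex.norm_real, norm_inv,
    norm_inv, norm_norm, norm_norm] at h
  have h2 := mul_le_mul_of_nonneg_right h.le (mul_pos hu1 hs1).le
  have e1 : D.rate * (‖s‖⁻¹ * ‖cocycleIter T a b E D.steps ω s‖) * (‖u‖ * ‖s‖) =
      D.rate * ‖cocycleIter T a b E D.steps ω s‖ * ‖u‖ := by field_simp
  have e2 : ‖u‖⁻¹ * ‖cocycleIter T a b E D.steps ω u‖ * (‖u‖ * ‖s‖) =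
      ‖cocycleIter T a b E D.steps ω u‖ * ‖s‖ := by field_simp
  rwa [e1, e2] at h2

theorem dominates_pow (k : ℕ) {ω : Ω} {u s : EuclideanSpace ℂ (Fin 2)}
    (hu : u ∈ line (D.unstable ω)) (hs : s ∈ line (D.stable ω)) :
    D.rate ^ k * ‖cocycleIter T a b E (D.steps * k) ω s‖ * ‖u‖ ≤
      ‖cocycleIter T a b E (D.steps * k) ω u‖ * ‖s‖ := by
  rcases eq_or_ne u 0 with rfl | hu0
  · simp
  induction k with
  | zero => simp [cocycleIter_zero, mul_comm]
  | succ k ih =>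
    have hs' := D.iter_stable (D.steps * k) ω hs
    have hu' := D.iter_unstable (D.steps * k) ω hu
    have h := D.dominates_mul hu' hs'
    -- Chaining the block estimates cancels this norm; injectivity on the unstable line makes it
    -- positive.
    have hpos : 0 < ‖cocycleIter T a b E (D.steps * k) ω u‖ :=
      norm_pos_iff.2 fun h => hu0 (D.iter_eq_zero _ hu h)
    rw [Nat.mul_succ, cocycleIter_add, cocycleIter_add]
    refine le_of_mul_le_mul_right ?_ hpos
    set s' := cocycleIter T a b E (D.steps * k) ω s
    set u' := cocycleIter T a b E (D.steps * k) ω u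
    set x := ‖cocycleIter T a b E D.steps ((T ^ ((D.steps * k : ℕ) : ℤ)) ω) s'‖
    set y := ‖cocycleIter T a b E D.steps ((T ^ ((D.steps * k : ℕ) : ℤ)) ω) u'‖
    have hr : 0 < D.rate := zero_lt_one.trans D.one_lt_rate
    calc D.rate ^ (k + 1) * x * ‖u‖ * ‖u'‖ = D.rate ^ k * ‖u‖ * (D.rate * x * ‖u'‖) := by ring
      _ ≤ D.rate ^ k * ‖u‖ * (y * ‖s'‖) := by gcongr
      _ = y * (D.rate ^ k * ‖s'‖ * ‖u‖) := by ring
      _ ≤ y * (‖u'‖ * ‖s‖) := by gcongr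
      _ = _ := by ring

/-- If the lines coincided, domination could be applied to `u` against itself, contradicting `1 <
rate`. -/
theorem cross_ne_zero {ω : Ω} {u s : EuclideanSpace ℂ (Fin 2)} (hu : u ∈ line (D.unstable ω))
    (hs : s ∈ line (D.stable ω)) (hu1 : u ≠ 0) (hs1 : s ≠ 0) : cross s u ≠ 0 := by
  intro h
  have h1 := D.dominates_mul hu (mem_line_of_cross_eq_zero hs hs1 h)
  have h2 : 0 < ‖cocycleIter T a b E D.steps ω u‖ * ‖u‖ :=
    mul_pos (norm_pos_iff.2 (D.norm_iter_pos hu hu1)) (norm_pos_iff.2 hu1)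
  have := D.one_lt_rate
  nlinarith

/-- The angle between the two directions is bounded away from zero. -/
theorem exists_le_norm_cross [CompactSpace Ω] : ∃ c : ℝ, 0 < c ∧ c ≤ 1 ∧ ∀ ω,
    ∀ s ∈ line (D.stable ω), ∀ u ∈ line (D.unstable ω), c * (‖s‖ * ‖u‖) ≤ ‖cross s u‖ := by
  let S := Metric.sphere (0 : EuclideanSpace ℂ (Fin 2)) 1
  let Z : Set (Ω × EuclideanSpace ℂ (Fin 2) × EuclideanSpace ℂ (Fin 2)) :=
    (Set.univ ×ˢ (S ×ˢ S)) ∩ ({p | p.2.1 ∈ line (D.stable p.1)} ∩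
      {p | p.2.2 ∈ line (D.unstable p.1)})
  have hZ : IsCompact Z := by
    refine (isCompact_univ.prod ((isCompact_sphere _ _).prod (isCompact_sphere _ _))).inter_right
      (IsClosed.inter ?_ ?_)
    · exact isClosed_setOf_mem_line.preimage
        (f := fun p : Ω × EuclideanSpace ℂ (Fin 2) × EuclideanSpace ℂ (Fin 2) =>
          (D.stable p.1, p.2.1))
        ((D.continuous_stable.comp continuous_fst).prodMk (by fun_prop))
    · exact isClosed_setOf_mem_line.preimage
        (f := fun p : Ω × EuclideanSpace ℂ (Fin 2) × EuclideanSpace ℂ (Fin 2) =>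
          (D.unstable p.1, p.2.2))
        ((D.continuous_unstable.comp continuous_fst).prodMk (by fun_prop))
  have hcont : ContinuousOn (fun p : Ω × EuclideanSpace ℂ (Fin 2) × EuclideanSpace ℂ (Fin 2) =>
      ‖cross p.2.1 p.2.2‖) Z := by
    refine Continuous.continuousOn ?_
    unfold cross
    fun_prop
  have hpos : ∀ p ∈ Z, 0 < ‖cross p.2.1 p.2.2‖ := by
    rintro ⟨ω, s, u⟩ ⟨⟨-, hs1, hu1⟩, hs, hu⟩
    refine norm_pos_iff.2 (D.cross_ne_zero hu hs ?_ ?_)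
    · exact ne_zero_of_mem_unit_sphere (⟨u, hu1⟩ : S)
    · exact ne_zero_of_mem_unit_sphere (⟨s, hs1⟩ : S)
  obtain ⟨c, hc, h⟩ := hZ.exists_forall_le' hcont hpos
  -- Capping the constant at `1` lets `c * ‖u‖ ≤ ‖s + u‖` hold also when `s = 0`.
  refine ⟨min c 1, by positivity, min_le_right _ _, fun ω s hs u hu => ?_⟩
  rcases eq_or_ne u 0 with rfl | hu0
  · simp
  rcases eq_or_ne s 0 with rfl | hs0
  · simp
  have hu1 := norm_pos_iff.2 hu0
  have hs1 := norm_pos_iff.2 hs0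
  have h1 := h (ω, ((‖s‖⁻¹ : ℝ) : ℂ) • s, ((‖u‖⁻¹ : ℝ) : ℂ) • u) ⟨⟨trivial,
    by
      simp only [S, mem_sphere_zero_iff_norm]
      rw [norm_smul, Complex.norm_real, norm_inv, norm_norm, inv_mul_cancel₀ hs1.ne'],
    by
      simp only [S, mem_sphere_zero_iff_norm]
      rw [norm_smul, Complex.norm_real, norm_inv, norm_norm, inv_mul_cancel₀ hu1.ne']⟩,
    Submodule.smul_mem _ _ hs, Submodule.smul_mem _ _ hu⟩
  have h2 : cross (((‖s‖⁻¹ : ℝ) : ℂ) • s) (((‖u‖⁻¹ : ℝ) : ℂ) • u) =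
      ((‖s‖⁻¹ * ‖u‖⁻¹ : ℝ) : ℂ) * cross s u := by
    simp [cross]
    ring
  simp only [h2, norm_mul, Complex.norm_real, norm_inv, norm_norm] at h1
  calc min c 1 * (‖s‖ * ‖u‖) ≤ c * (‖s‖ * ‖u‖) := by gcongr; exact min_le_left _ _
    _ ≤ ‖s‖⁻¹ * ‖u‖⁻¹ * ‖cross s u‖ * (‖s‖ * ‖u‖) := by gcongr
    _ = _ := by field_simp

theorem exists_add_eq (ω : Ω) (v : EuclideanSpace ℂ (Fin 2)) :
    ∃ s u, s ∈ line (D.stable ω) ∧ u ∈ line (D.unstable ω) ∧ v = s + u := by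
  obtain ⟨s, hs, hs1⟩ := exists_mem_line_norm_eq_one (D.stable ω)
  obtain ⟨u, hu, hu1⟩ := exists_mem_line_norm_eq_one (D.unstable ω)
  have h := D.cross_ne_zero hu hs (norm_ne_zero_iff.1 (by simp [hu1]))
    (norm_ne_zero_iff.1 (by simp [hs1]))
  refine ⟨(cross v u / cross s u) • s, (cross s v / cross s u) • u, Submodule.smul_mem _ _ hs,
    Submodule.smul_mem _ _ hu, ?_⟩
  ext i
  simp only [PiLp.add_apply, PiLp.smul_apply, smul_eq_mul]
  field_simp
  fin_cases i <;> simp only [cross, Fin.zero_eta, Fin.mk_one] <;> ring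

theorem eq_zero_of_mem_of_mem {ω : Ω} {v : EuclideanSpace ℂ (Fin 2)}
    (hs : v ∈ line (D.stable ω)) (hu : v ∈ line (D.unstable ω)) : v = 0 := by
  by_contra h
  exact D.cross_ne_zero hu hs h h (by simp [cross, mul_comm])

theorem add_inj {ω : Ω} {s s' u u' : EuclideanSpace ℂ (Fin 2)}
    (hs : s ∈ line (D.stable ω)) (hu : u ∈ line (D.unstable ω))
    (hs' : s' ∈ line (D.stable ω)) (hu' : u' ∈ line (D.unstable ω)) (h : s + u = s' + u') :
    s = s' ∧ u = u' := by
  have h1 : s - s' = u' - u := by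
    rw [sub_eq_sub_iff_add_eq_add, h, add_comm]
  have h2 := D.eq_zero_of_mem_of_mem (Submodule.sub_mem _ hs hs')
    (h1 ▸ Submodule.sub_mem _ hu' hu)
  refine ⟨sub_eq_zero.1 h2, ?_⟩
  rw [h2] at h1
  exact (sub_eq_zero.1 h1.symm).symm

end JacobiSplitting

end Splitting

/-! ### A dominated splitting excludes nonzero bounded solutions. -/

theorem eq_zero_of_forall_pow_mul_le {c r x C : ℝ} (hc : 0 < c) (hr : 1 < r) (hx : 0 ≤ x)
    (h : ∀ k : ℕ, c * r ^ k * x ≤ C) : x = 0 := by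
  by_contra h0
  have hpos : 0 < c * x := mul_pos hc (lt_of_le_of_ne hx (Ne.symm h0))
  obtain ⟨k, hk⟩ := pow_unbounded_of_one_lt (C / (c * x)) hr
  rw [div_lt_iff₀ hpos] at hk
  linarith [h k]

/-- Both sides are the product over one longer window. With `f = ‖a‖` along the orbit, this compares
the determinant with the square of `∏ ‖a‖` up to two edge factors. -/
theorem mul_prod_range_eq_prod_range_mul {f : ℤ → ℝ} (m : ℤ) (n : ℕ) :
    f (m - 1) * ∏ j ∈ Finset.range n, f (m + j) =
      (∏ j ∈ Finset.range n, f (m + j - 1)) * f (m + n - 1) := by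
  induction n with
  | zero => simp
  | succ n ih =>
    rw [Finset.prod_range_succ, ← mul_assoc, ih, Finset.prod_range_succ]
    push_cast
    rw [show m + ((n : ℤ) + 1) - 1 = m + n by ring]

namespace JacobiSplitting

variable {Ω : Type*} [MetricSpace Ω] {T : Ω ≃ₜ Ω} {a : C(Ω, ℂ)} {b : C(Ω, ℝ)} {E : ℂ}
  (D : JacobiSplitting T a b E)

/-- The determinant is at most a constant times `‖B s‖ * ‖B u‖` for unit vectors, by the angle bound
at the start, and domination replaces `‖B s‖` by `rate ^ (-k) * ‖B u‖`. -/
theorem le_norm_iter_unstable_sq {c : ℝ} (hc : ∀ ω, ∀ s ∈ line (D.stable ω),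
      ∀ u ∈ line (D.unstable ω), c * (‖s‖ * ‖u‖) ≤ ‖cross s u‖) (k : ℕ) {ω : Ω}
    {u : EuclideanSpace ℂ (Fin 2)} (hu : u ∈ line (D.unstable ω)) :
    c * D.rate ^ k * ‖∏ j ∈ Finset.range (D.steps * k), a ((T ^ (j : ℤ)) ω) *
        (starRingEnd ℂ) (a ((T ^ ((j : ℤ) - 1)) ω))‖ * ‖u‖ ^ 2 ≤
      ‖cocycleIter T a b E (D.steps * k) ω u‖ ^ 2 := by
  obtain ⟨s, hs, hs1⟩ := exists_mem_line_norm_eq_one (D.stable ω)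
  have h1 := congrArg norm (cross_cocycleIter T a b E (D.steps * k) ω s u)
  have h2 := D.dominates_pow k hu hs
  have h3 := hc ω s hs u hu
  have h4 := norm_cross_le (cocycleIter T a b E (D.steps * k) ω s)
    (cocycleIter T a b E (D.steps * k) ω u)
  rw [h1, norm_mul] at h4
  rw [hs1] at h2 h3
  have hr : 0 < D.rate ^ k := pow_pos (zero_lt_one.trans D.one_lt_rate) k
  set δ := ‖∏ j ∈ Finset.range (D.steps * k), a ((T ^ (j : ℤ)) ω) *
        (starRingEnd ℂ) (a ((T ^ ((j : ℤ) - 1)) ω))‖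
  set x := ‖cocycleIter T a b E (D.steps * k) ω s‖
  set y := ‖cocycleIter T a b E (D.steps * k) ω u‖
  calc c * D.rate ^ k * δ * ‖u‖ ^ 2 = D.rate ^ k * ‖u‖ * (δ * (c * (1 * ‖u‖))) := by ring
    _ ≤ D.rate ^ k * ‖u‖ * (δ * ‖cross s u‖) := by gcongr
    _ ≤ D.rate ^ k * ‖u‖ * (x * y) := by gcongr
    _ = (D.rate ^ k * x * ‖u‖) * y := by ring
    _ ≤ (y * 1) * y := by gcongr
    _ = y ^ 2 := by ring

/-- The mirror image: the angle bound is used at the end of the orbit segment, and domination bounds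
`‖B u‖` from below by `‖B s‖`. -/
theorem norm_iter_stable_sq_le {c : ℝ} (hc0 : 0 ≤ c) (hc : ∀ ω, ∀ s ∈ line (D.stable ω),
      ∀ u ∈ line (D.unstable ω), c * (‖s‖ * ‖u‖) ≤ ‖cross s u‖) (k : ℕ) {ω : Ω}
    {s : EuclideanSpace ℂ (Fin 2)} (hs : s ∈ line (D.stable ω)) :
    c * D.rate ^ k * ‖cocycleIter T a b E (D.steps * k) ω s‖ ^ 2 ≤
      ‖∏ j ∈ Finset.range (D.steps * k), a ((T ^ (j : ℤ)) ω) *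
        (starRingEnd ℂ) (a ((T ^ ((j : ℤ) - 1)) ω))‖ * ‖s‖ ^ 2 := by
  obtain ⟨u, hu, hu1⟩ := exists_mem_line_norm_eq_one (D.unstable ω)
  have h1 := congrArg norm (cross_cocycleIter T a b E (D.steps * k) ω s u)
  have h2 := D.dominates_pow k hu hs
  have h3 := hc _ _ (D.iter_stable (D.steps * k) ω hs) _ (D.iter_unstable (D.steps * k) ω hu)
  have h4 := norm_cross_le s u
  rw [h1, norm_mul] at h3
  rw [hu1] at h2 h4
  set δ := ‖∏ j ∈ Finset.range (D.steps * k), a ((T ^ (j : ℤ)) ω) *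
        (starRingEnd ℂ) (a ((T ^ ((j : ℤ) - 1)) ω))‖
  set x := ‖cocycleIter T a b E (D.steps * k) ω s‖
  set y := ‖cocycleIter T a b E (D.steps * k) ω u‖
  calc c * D.rate ^ k * x ^ 2 = c * x * (D.rate ^ k * x * 1) := by ring
    _ ≤ c * x * (y * ‖s‖) := by gcongr
    _ = c * (x * y) * ‖s‖ := by ring
    _ ≤ (δ * ‖cross s u‖) * ‖s‖ := by gcongr
    _ ≤ (δ * (‖s‖ * 1)) * ‖s‖ := by gcongr
    _ = _ := by ring

theorem iter_eq_prod_smul {ω : Ω} {x : ℤ → EuclideanSpace ℂ (Fin 2)}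
    (h : ∀ n, cocycleStep T a b E ((T ^ n) ω) (x n) = a ((T ^ n) ω) • x (n + 1)) (m : ℤ) (n : ℕ) :
    cocycleIter T a b E n ((T ^ m) ω) (x m) =
      (∏ j ∈ Finset.range n, a ((T ^ (m + j)) ω)) • x (m + n) := by
  induction n with
  | zero => simp [cocycleIter_zero]
  | succ n ih =>
    rw [cocycleIter_succ, ih, map_smul, zpow_apply_zpow_apply, add_comm (n : ℤ), h,
      Finset.prod_range_succ, smul_smul, Nat.cast_succ, add_assoc]

theorem norm_prod_mul_conj (ω : Ω) (m : ℤ) (n : ℕ) :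
    ‖∏ j ∈ Finset.range n, a ((T ^ (j : ℤ)) ((T ^ m) ω)) *
        (starRingEnd ℂ) (a ((T ^ ((j : ℤ) - 1)) ((T ^ m) ω)))‖ =
      (∏ j ∈ Finset.range n, ‖a ((T ^ (m + j)) ω)‖) *
        ∏ j ∈ Finset.range n, ‖a ((T ^ (m + j - 1)) ω)‖ := by
  rw [norm_prod, ← Finset.prod_mul_distrib]
  refine Finset.prod_congr rfl fun j _ => ?_
  rw [norm_mul, RCLike.norm_conj, zpow_apply_zpow_apply, zpow_apply_zpow_apply, add_comm (j : ℤ),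
    show (j : ℤ) - 1 + m = m + j - 1 by ring]

/-- A bounded solution has no component in the dominating direction. -/
theorem unstable_part_eq_zero [CompactSpace Ω] {ω : Ω} {u : ℤ → EuclideanSpace ℂ (Fin 2)} {M : ℝ}
    (hu : ∀ n, u n ∈ line (D.unstable ((T ^ n) ω)))
    (h : ∀ n, cocycleStep T a b E ((T ^ n) ω) (u n) = a ((T ^ n) ω) • u (n + 1))
    (hM : ∀ n, ‖u n‖ ≤ M) (m : ℤ) : u m = 0 := by
  obtain ⟨c, hc0, -, hc⟩ := D.exists_le_norm_cross
  by_cases hz : ∃ j : ℕ, a ((T ^ (m + j)) ω) = 0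
  · obtain ⟨j, hj⟩ := hz
    refine D.iter_eq_zero (j + 1) (hu m) ?_
    rw [iter_eq_prod_smul h, Finset.prod_range_succ, hj, mul_zero, zero_smul]
  push Not at hz
  -- The telescoped estimate carries the factor `‖a (T^(m-1) ω)‖`, which may vanish. It is therefore
  -- used at `m + 1`, and injectivity on the unstable line brings the conclusion back to `m`.
  have key : ∀ m : ℤ, (∀ j : ℕ, a ((T ^ (m + j)) ω) ≠ 0) → a ((T ^ (m - 1)) ω) ≠ 0 →
      u m = 0 := by
    intro m hz hm
    have h0 : ‖a ((T ^ (m - 1)) ω)‖ * ‖u m‖ ^ 2 = 0 := by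
      refine eq_zero_of_forall_pow_mul_le (C := ‖a‖ * M ^ 2) hc0 D.one_lt_rate (by positivity)
        fun k => ?_
      have h1 := D.le_norm_iter_unstable_sq hc k (hu m)
      rw [norm_prod_mul_conj, iter_eq_prod_smul h, norm_smul, norm_prod] at h1
      have h2 := mul_prod_range_eq_prod_range_mul (f := fun j => ‖a ((T ^ j) ω)‖) m (D.steps * k)
      have hpos : 0 < ∏ j ∈ Finset.range (D.steps * k), ‖a ((T ^ (m + j)) ω)‖ :=
        Finset.prod_pos fun j _ => norm_pos_iff.2 (hz j)
      have h3 : ‖a ((T ^ (m + (D.steps * k : ℕ) - 1)) ω)‖ ≤ ‖a‖ := a.norm_coe_le_norm _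
      have h4 := hM (m + (D.steps * k : ℕ))
      set p := ∏ j ∈ Finset.range (D.steps * k), ‖a ((T ^ (m + j)) ω)‖
      set q := ∏ j ∈ Finset.range (D.steps * k), ‖a ((T ^ (m + j - 1)) ω)‖
      set z := ‖a ((T ^ (m + (D.steps * k : ℕ) - 1)) ω)‖
      refine le_of_mul_le_mul_right ?_ (mul_pos hpos hpos)
      calc c * D.rate ^ k * (‖a ((T ^ (m - 1)) ω)‖ * ‖u m‖ ^ 2) * (p * p)
          = c * D.rate ^ k * (p * (‖a ((T ^ (m - 1)) ω)‖ * p)) * ‖u m‖ ^ 2 := by ring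
        _ = z * (c * D.rate ^ k * (p * q) * ‖u m‖ ^ 2) := by rw [h2]; ring
        _ ≤ z * (p * ‖u (m + (D.steps * k : ℕ))‖) ^ 2 := by gcongr
        _ ≤ ‖a‖ * (p * M) ^ 2 := by gcongr
        _ = _ := by ring
    have h1 := (mul_eq_zero.1 h0).resolve_left (norm_ne_zero_iff.2 hm)
    simpa using h1
  have h1 : u (m + 1) = 0 := by
    refine key (m + 1) (fun j => ?_) (by simpa using hz 0)
    have := hz (j + 1)
    rwa [Nat.cast_succ, add_comm (j : ℤ), ← add_assoc] at this
  refine D.step_eq_zero (hu m) ?_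
  rw [h, h1, smul_zero]

/-- A bounded solution has no component in the dominated direction, if the off-diagonal entries
to the left do not vanish. -/
theorem stable_part_eq_zero [CompactSpace Ω] {ω : Ω} {s : ℤ → EuclideanSpace ℂ (Fin 2)} {M : ℝ}
    (hs : ∀ n, s n ∈ line (D.stable ((T ^ n) ω)))
    (h : ∀ n, cocycleStep T a b E ((T ^ n) ω) (s n) = a ((T ^ n) ω) • s (n + 1))
    (hM : ∀ n, ‖s n‖ ≤ M) (m : ℤ) (hz : ∀ j < m, a ((T ^ j) ω) ≠ 0) : s m = 0 := by
  obtain ⟨c, hc0, -, hc⟩ := D.exists_le_norm_cross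
  have h0 : ‖a ((T ^ (m - 1)) ω)‖ * ‖s m‖ ^ 2 = 0 := by
    refine eq_zero_of_forall_pow_mul_le (C := ‖a‖ * M ^ 2) hc0 D.one_lt_rate (by positivity)
      fun k => ?_
    have h1 := D.norm_iter_stable_sq_le hc0.le hc k (hs (m - (D.steps * k : ℕ)))
    have h2 := mul_prod_range_eq_prod_range_mul (f := fun j => ‖a ((T ^ j) ω)‖)
      (m - (D.steps * k : ℕ)) (D.steps * k)
    rw [norm_prod_mul_conj, iter_eq_prod_smul h, norm_smul, norm_prod] at h1
    simp only [sub_add_cancel] at h1 h2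
    have hpos : 0 < ∏ j ∈ Finset.range (D.steps * k),
        ‖a ((T ^ (m - (D.steps * k : ℕ) + j)) ω)‖ :=
      Finset.prod_pos fun j hj => norm_pos_iff.2 (hz _ (by
        have := Finset.mem_range.1 hj
        omega))
    have h3 : ‖a ((T ^ (m - (D.steps * k : ℕ) - 1)) ω)‖ ≤ ‖a‖ := a.norm_coe_le_norm _
    have h4 := hM (m - (D.steps * k : ℕ))
    set p := ∏ j ∈ Finset.range (D.steps * k), ‖a ((T ^ (m - (D.steps * k : ℕ) + j)) ω)‖
    set q := ∏ j ∈ Finset.range (D.steps * k), ‖a ((T ^ (m - (D.steps * k : ℕ) + j - 1)) ω)‖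
    set z := ‖a ((T ^ (m - (D.steps * k : ℕ) - 1)) ω)‖
    refine le_of_mul_le_mul_right ?_ (mul_pos hpos hpos)
    calc c * D.rate ^ k * (‖a ((T ^ (m - 1)) ω)‖ * ‖s m‖ ^ 2) * (p * p)
        = ‖a ((T ^ (m - 1)) ω)‖ * (c * D.rate ^ k * (p * ‖s m‖) ^ 2) := by ring
      _ ≤ ‖a ((T ^ (m - 1)) ω)‖ * (p * q * ‖s (m - (D.steps * k : ℕ))‖ ^ 2) := by gcongr
      _ = (z * p) * p * ‖s (m - (D.steps * k : ℕ))‖ ^ 2 := by rw [h2]; ring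
      _ ≤ (‖a‖ * p) * p * M ^ 2 := by gcongr
      _ = _ := by ring
  have h1 := (mul_eq_zero.1 h0).resolve_left (norm_ne_zero_iff.2 (hz _ (by omega)))
  simpa using h1

/-- When `a (T^(m-1) ω) = 0`, the vector `(0, 1)` is in the kernel of `B`. Injectivity on the
unstable line removes its unstable part, so it spans the stable line. -/
theorem apply_zero_eq_zero_of_mem_stable {ω : Ω} {m : ℤ} (hm : a ((T ^ (m - 1)) ω) = 0)
    {v : EuclideanSpace ℂ (Fin 2)} (hv : v ∈ line (D.stable ((T ^ m) ω))) : v 0 = 0 := by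
  obtain ⟨s, u, hs, hu, hsu⟩ := D.exists_add_eq ((T ^ m) ω) !₂[0, 1]
  have h0 : cocycleStep T a b E ((T ^ m) ω) !₂[0, 1] = 0 := by
    rw [cocycleStep_apply]
    ext i
    fin_cases i <;> simp [hm]
  rw [hsu, map_add] at h0
  have h1 := (D.add_inj (D.step_stable _ _ hs) (D.step_unstable _ _ hu) (Submodule.zero_mem _)
    (Submodule.zero_mem _) (h0.trans (add_zero 0).symm)).2
  rw [D.step_eq_zero hu h1, add_zero] at hsu
  have h2 := cross_eq_zero_of_mem_line hv hs
  rw [← hsu] at h2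
  simpa [cross] using h2

/-- In the presence of a dominated splitting, bounded solutions vanish. -/
theorem eq_zero_of_bounded [CompactSpace Ω] (D : JacobiSplitting T a b E) {ω : Ω}
    {ψ : ℤ → ℂ} {M : ℝ} (h : ∀ n, jacobiDiff T a b E ω ψ n = 0)
    (hM : ∀ n, ‖ψ n‖ ≤ M) (n : ℤ) : ψ n = 0 := by
  choose s u hs hu hsu using fun n => D.exists_add_eq ((T ^ n) ω) !₂[ψ n, ψ (n - 1)]
  have hstep : ∀ n, cocycleStep T a b E ((T ^ n) ω) (s n) = a ((T ^ n) ω) • s (n + 1) ∧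
      cocycleStep T a b E ((T ^ n) ω) (u n) = a ((T ^ n) ω) • u (n + 1) := by
    intro n
    have h1 := cocycleStep_pair_eq T a b E ω n ψ (h n)
    have h2 := hsu (n + 1)
    rw [add_sub_cancel_right] at h2
    rw [h2, hsu n, map_add, smul_add] at h1
    have hs' := D.step_stable _ _ (hs n)
    have hu' := D.step_unstable _ _ (hu n)
    rw [apply_zpow_apply] at hs' hu'
    exact D.add_inj hs' hu' (Submodule.smul_mem _ _ (hs _)) (Submodule.smul_mem _ _ (hu _)) h1
  have hM0 : 0 ≤ M := (norm_nonneg _).trans (hM 0)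
  have hw : ∀ n, ‖!₂[ψ n, ψ (n - 1)]‖ ≤ 2 * M := by
    intro n
    rw [EuclideanSpace.norm_eq, Fin.sum_univ_two]
    refine Real.sqrt_le_iff.2 ⟨by positivity, ?_⟩
    have h1 := pow_le_pow_left₀ (norm_nonneg _) (hM n) 2
    have h2 := pow_le_pow_left₀ (norm_nonneg _) (hM (n - 1)) 2
    simp
    nlinarith [sq_nonneg M]
  obtain ⟨c, hc0, hc1, hc⟩ := D.exists_le_norm_cross
  have hub : ∀ n, ‖u n‖ ≤ 2 * M / c := by
    intro n
    rw [le_div_iff₀' hc0]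
    refine le_trans ?_ (hw n)
    rw [hsu n]
    rcases eq_or_ne (s n) 0 with h0 | h0
    · rw [h0, zero_add]
      exact mul_le_of_le_one_left (norm_nonneg _) hc1
    · refine le_of_mul_le_mul_left ?_ (norm_pos_iff.2 h0)
      have h1 := hc _ _ (hs n) _ (hu n)
      -- Hence the angle bound gives `c * ‖u n‖ ≤ ‖s n + u n‖`, so the unstable part inherits
      -- boundedness from `ψ`.
      have h2 : cross (s n) (u n) = cross (s n) (s n + u n) := by
        simp only [cross, PiLp.add_apply]
        ring
      rw [h2] at h1
      have h3 := norm_cross_le (s n) (s n + u n)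
      linarith
  have hu0 := D.unstable_part_eq_zero hu (fun n => (hstep n).2) hub
  have hs0 : ∀ n, !₂[ψ n, ψ (n - 1)] = s n := fun n => by rw [hsu n, hu0 n, add_zero]
  have hsb : ∀ n, ‖s n‖ ≤ 2 * M := fun n => hs0 n ▸ hw n
  have hv : ∀ m, a ((T ^ (m - 1)) ω) = 0 → ψ m = 0 := by
    intro m hm
    have h1 := D.apply_zero_eq_zero_of_mem_stable hm (hs m)
    rw [← hs0 m] at h1
    simpa using h1
  by_cases hz : ∃ j < n, a ((T ^ j) ω) = 0
  · obtain ⟨j, hjn, hj⟩ := hz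
    obtain ⟨i, rfl⟩ : ∃ i : ℕ, n = j + 1 + i := ⟨(n - (j + 1)).toNat, by omega⟩
    -- The solution vanishes to the right of a zero of `a`. The second conjunct is the
    -- left-neighbour term of the equation; at the start it vanishes because of `a`, later because
    -- of `ψ`.
    have hind : ∀ i : ℕ, ψ (j + 1 + i) = 0 ∧ a ((T ^ (j + i)) ω) * ψ (j + i) = 0 := by
      intro i
      induction i with
      | zero => exact ⟨hv _ (by simpa using hj), by simp [hj]⟩
      | succ i ih =>
        have e1 : j + ((i + 1 : ℕ) : ℤ) = j + 1 + i := by push_cast; ring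
        have e2 : j + 1 + ((i + 1 : ℕ) : ℤ) = j + 1 + i + 1 := by push_cast; ring
        rw [e1, e2]
        refine ⟨?_, by simp [ih.1]⟩
        by_cases h0 : a ((T ^ (j + 1 + (i : ℤ))) ω) = 0
        · exact hv _ (by simpa using h0)
        · have h1 := h (j + 1 + i)
          have e3 : j + 1 + (i : ℤ) - 1 = j + i := by ring
          rw [jacobiDiff, ih.1, e3] at h1
          have h2 : (starRingEnd ℂ) (a ((T ^ (j + (i : ℤ))) ω)) * ψ (j + i) = 0 := by
            rcases mul_eq_zero.1 ih.2 with h2 | h2 <;> simp [h2]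
          rw [h2] at h1
          simpa [h0] using h1
    exact (hind i).1
  · push Not at hz
    have h1 := D.stable_part_eq_zero hs (fun n => (hstep n).1) hsb n hz
    rw [← hs0 n] at h1
    simpa using congrArg (fun v : EuclideanSpace ℂ (Fin 2) => v 0) h1

end JacobiSplitting

/-! ### Summation estimates in `ℓ²(ℤ)`. -/

section L2

theorem L2Z.summable_norm_sq (ψ : L2Z) : Summable fun n => ‖ψ n‖ ^ 2 := by
  have h := (lp.memℓp ψ).summable (by norm_num)
  simpa only [ENNReal.toReal_ofNat, Real.rpow_two] using h

theorem L2Z.norm_sq_eq_tsum (ψ : L2Z) : ‖ψ‖ ^ 2 = ∑' n, ‖ψ n‖ ^ 2 := by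
  have h := lp.norm_rpow_eq_tsum (by norm_num) ψ
  simpa only [ENNReal.toReal_ofNat, Real.rpow_two] using h

theorem L2Z.norm_le_of_forall_sum_le {ψ : L2Z} {C : ℝ} (hC : 0 ≤ C)
    (h : ∀ s : Finset ℤ, ∑ n ∈ s, ‖ψ n‖ ^ 2 ≤ C ^ 2) : ‖ψ‖ ≤ C := by
  refine lp.norm_le_of_forall_sum_le (by norm_num) hC fun s => ?_
  simpa only [ENNReal.toReal_ofNat, Real.rpow_two] using h s

theorem L2Z.norm_apply_le (ψ : L2Z) (n : ℤ) : ‖ψ n‖ ≤ ‖ψ‖ :=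
  lp.norm_apply_le_norm (by norm_num) ψ n

theorem summable_pow_natAbs {q : ℝ} (h0 : 0 ≤ q) (h1 : q < 1) :
    Summable fun n : ℤ => q ^ n.natAbs := by
  have h := summable_geometric_of_lt_one h0 h1
  exact Summable.of_nat_of_neg (by simpa using h) (by simpa using h)

theorem sum_pow_natAbs_sub_le {q : ℝ} (h0 : 0 ≤ q) (h1 : q < 1) (n : ℤ) (s : Finset ℤ) :
    ∑ m ∈ s, q ^ (n - m).natAbs ≤ ∑' k : ℤ, q ^ k.natAbs := by
  have h := summable_pow_natAbs h0 h1
  have h2 := (Equiv.subLeft n).summable_iff.2 h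
  have h3 := (Equiv.subLeft n).tsum_eq fun k : ℤ => q ^ k.natAbs
  simp only [Function.comp_def, Equiv.subLeft_apply] at h2 h3
  rw [← h3]
  exact h2.sum_le_tsum s fun i _ => pow_nonneg h0 _

/-- A weighted pointwise bound by an exponentially localized supremum gives an `ℓ²` bound. -/
theorem L2Z.norm_le_of_pointwise {ψ f : L2Z} {c r : ℝ} (hc : 0 < c) (h0 : 0 < r) (h1 : r < 1)
    (h : ∀ m : ℤ, ∀ ε : ℝ, (∀ n : ℤ, r ^ (n - m).natAbs * ‖f n‖ ≤ ε) → c * ‖ψ m‖ ≤ ε) :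
    c * ‖ψ‖ ≤ √(∑' k : ℤ, (r ^ 2) ^ k.natAbs) * ‖f‖ := by
  have hq0 : 0 ≤ r ^ 2 := by positivity
  have hq1 : r ^ 2 < 1 := by nlinarith
  have hF := f.summable_norm_sq
  have hsum : ∀ m : ℤ, Summable fun n : ℤ => (r ^ 2) ^ (n - m).natAbs * ‖f n‖ ^ 2 := fun m =>
    Summable.of_nonneg_of_le (fun n => by positivity)
      (fun n => mul_le_of_le_one_left (by positivity) (pow_le_one₀ hq0 hq1.le)) hF
  have hpt : ∀ m : ℤ, c ^ 2 * ‖ψ m‖ ^ 2 ≤ ∑' n : ℤ, (r ^ 2) ^ (n - m).natAbs * ‖f n‖ ^ 2 := by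
    intro m
    -- A weighted supremum is at most the weighted `ℓ²` norm; summing its square over `m` and
    -- exchanging sums leaves a geometric series.
    have h2 := h m (√(∑' n : ℤ, (r ^ 2) ^ (n - m).natAbs * ‖f n‖ ^ 2)) (fun n => by
      refine Real.le_sqrt_of_sq_le ?_
      rw [mul_pow, ← pow_mul, mul_comm _ 2, pow_mul]
      exact (hsum m).le_tsum n (fun _ _ => by positivity))
    have h3 := pow_le_pow_left₀ (by positivity) h2 2
    rwa [Real.sq_sqrt (tsum_nonneg fun n => by positivity), mul_pow] at h3
  rw [← le_div_iff₀' hc]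
  refine L2Z.norm_le_of_forall_sum_le (by positivity) fun s => ?_
  rw [div_pow, mul_pow, Real.sq_sqrt (tsum_nonneg fun n => by positivity), f.norm_sq_eq_tsum,
    le_div_iff₀' (by positivity), Finset.mul_sum]
  calc ∑ m ∈ s, c ^ 2 * ‖ψ m‖ ^ 2
      ≤ ∑ m ∈ s, ∑' n : ℤ, (r ^ 2) ^ (n - m).natAbs * ‖f n‖ ^ 2 :=
        Finset.sum_le_sum fun m _ => hpt m
    _ = ∑' n : ℤ, ∑ m ∈ s, (r ^ 2) ^ (n - m).natAbs * ‖f n‖ ^ 2 :=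
        (Summable.tsum_finsetSum fun m _ => hsum m).symm
    _ ≤ ∑' n : ℤ, (∑' k : ℤ, (r ^ 2) ^ k.natAbs) * ‖f n‖ ^ 2 := by
        refine Summable.tsum_le_tsum (fun n => ?_) (summable_sum fun m _ => hsum m)
          (hF.mul_left _)
        rw [← Finset.sum_mul]
        exact mul_le_mul_of_nonneg_right (sum_pow_natAbs_sub_le hq0 hq1 n s) (by positivity)
    _ = _ := tsum_mul_left

end L2

/-! ### From absence of bounded solutions to an `ℓ²` lower bound. -/

section LowerBound

variable {Ω : Type*} [MetricSpace Ω] (T : Ω ≃ₜ Ω) (a : C(Ω, ℂ)) (b : C(Ω, ℝ)) (E : ℂ)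

theorem jacobiDiff_const_mul (ω : Ω) (z : ℂ) (ψ : ℤ → ℂ) (n : ℤ) :
    jacobiDiff T a b E ω (fun j => z * ψ j) n = z * jacobiDiff T a b E ω ψ n := by
  simp only [jacobiDiff]
  ring

theorem continuous_jacobiDiff (n : ℤ) :
    Continuous fun p : Ω × (ℤ → ℂ) => jacobiDiff T a b E p.1 p.2 n := by
  have h : ∀ n : ℤ, Continuous fun p : Ω × (ℤ → ℂ) => (T ^ n) p.1 := fun n =>
    (T ^ n).continuous.comp continuous_fst
  have ha : ∀ n : ℤ, Continuous fun p : Ω × (ℤ → ℂ) => a ((T ^ n) p.1) := fun n =>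
    a.continuous.comp (h n)
  have hb : Continuous fun p : Ω × (ℤ → ℂ) => b ((T ^ n) p.1) := b.continuous.comp (h n)
  have hψ : ∀ n : ℤ, Continuous fun p : Ω × (ℤ → ℂ) => p.2 n := fun n => by fun_prop
  exact (((Complex.continuous_conj.comp (ha _)).mul (hψ _)).add ((ha _).mul (hψ _))).add
    (((Complex.continuous_ofReal.comp hb).sub continuous_const).mul (hψ _))

variable {T a b E}

/-- Otherwise approximate solutions with error tending to `0` exist. The sets of such pairs `(ω, ψ)`
are nested, nonempty and compact in the product topology, and a common point is an exact bounded
solution with `‖ψ 0‖ ≥ 1/2`. -/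
theorem exists_lt_norm_jacobiDiff [CompactSpace Ω]
    (h : ∀ ω ψ, (∀ n, ‖ψ n‖ ≤ 1) → (∀ n, jacobiDiff T a b E ω ψ n = 0) → ψ 0 = 0) :
    ∃ c : ℝ, 0 < c ∧ ∀ ω ψ, (∀ n, ‖ψ n‖ ≤ 1) → 1 / 2 ≤ ‖ψ 0‖ →
      ∃ n, c < ‖jacobiDiff T a b E ω ψ n‖ := by
  by_contra! hcon
  let Z : ℕ → Set (Ω × (ℤ → ℂ)) := fun k =>
    (Set.univ ×ˢ Set.pi Set.univ fun _ => Metric.closedBall 0 1) ∩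
      ({p | 1 / 2 ≤ ‖p.2 0‖} ∩ ⋂ n, {p | ‖jacobiDiff T a b E p.1 p.2 n‖ ≤ 1 / ((k : ℝ) + 1)})
  have hclosed : ∀ k, IsClosed ({p : Ω × (ℤ → ℂ) | 1 / 2 ≤ ‖p.2 0‖} ∩
      ⋂ n, {p | ‖jacobiDiff T a b E p.1 p.2 n‖ ≤ 1 / ((k : ℝ) + 1)}) := fun k => by
    refine (isClosed_le continuous_const (by fun_prop)).inter (isClosed_iInter fun n => ?_)
    exact isClosed_le (continuous_jacobiDiff T a b E n).norm continuous_const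
  have hcompact : IsCompact ((Set.univ : Set Ω) ×ˢ
      Set.pi Set.univ fun _ : ℤ => Metric.closedBall (0 : ℂ) 1) :=
    isCompact_univ.prod (isCompact_univ_pi fun _ => isCompact_closedBall _ _)
  obtain ⟨⟨ω, ψ⟩, hp⟩ := IsCompact.nonempty_iInter_of_sequence_nonempty_isCompact_isClosed Z
    (fun k => by
      rintro p ⟨h1, h2, h3⟩
      refine ⟨h1, h2, Set.mem_iInter.2 fun n => ?_⟩
      have h4 : ‖jacobiDiff T a b E p.1 p.2 n‖ ≤ _ := Set.mem_iInter.1 h3 n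
      refine le_trans h4 ?_
      push_cast
      gcongr
      linarith)
    (fun k => by
      obtain ⟨ω, ψ, h1, h2, h3⟩ := hcon (1 / ((k : ℝ) + 1)) (by positivity)
      exact ⟨(ω, ψ), ⟨trivial, fun n _ => by simpa using h1 n⟩, h2, Set.mem_iInter.2 h3⟩)
    (hcompact.inter_right (by exact_mod_cast hclosed 0))
    (fun k => (hcompact.inter_right (hclosed k)).isClosed)
  rw [Set.mem_iInter] at hp
  have h0 := h ω ψ (fun n => by simpa using (hp 0).1.2 n trivial) (fun n => by
    refine norm_le_zero_iff.1 (ge_of_tendsto' tendsto_one_div_add_atTop_nhds_zero_nat fun k => ?_)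
    exact Set.mem_iInter.1 (hp k).2.2 n)
  have h1 := (hp 0).2.1
  simp only [Set.mem_ofPred_eq, h0] at h1
  norm_num at h1

/-- Divide by the supremum and translate an index where more than half of it is reached to the
origin. Translation changes `ω`, so uniformity of `c` in `ω` is essential. -/
theorem mul_norm_le_of_norm_jacobiDiff_le {c : ℝ} (hc : 0 < c)
    (h : ∀ ω ψ, (∀ n, ‖ψ n‖ ≤ 1) → 1 / 2 ≤ ‖ψ 0‖ → ∃ n, c < ‖jacobiDiff T a b E ω ψ n‖)
    {ω : Ω} {ψ : ℤ → ℂ} {M ε : ℝ} (hM : ∀ n, ‖ψ n‖ ≤ M)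
    (hε : ∀ n, ‖jacobiDiff T a b E ω ψ n‖ ≤ ε) (n : ℤ) : c * ‖ψ n‖ ≤ ε := by
  have hbdd : BddAbove (Set.range fun n => ‖ψ n‖) := ⟨M, by rintro _ ⟨n, rfl⟩; exact hM n⟩
  have hle : ∀ n, ‖ψ n‖ ≤ ⨆ n, ‖ψ n‖ := fun n => le_ciSup hbdd n
  set S := ⨆ n, ‖ψ n‖ with hS
  rcases (show 0 ≤ S from (norm_nonneg _).trans (hle 0)).eq_or_lt with h0 | h0
  · have h1 : ‖ψ n‖ = 0 := le_antisymm (h0 ▸ hle n) (norm_nonneg _)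
    rw [h1, mul_zero]
    exact (norm_nonneg _).trans (hε 0)
  obtain ⟨m, hm⟩ := exists_lt_of_lt_ciSup (show S / 2 < ⨆ n, ‖ψ n‖ by rw [← hS]; linarith)
  have hSn : ‖((S⁻¹ : ℝ) : ℂ)‖ = S⁻¹ := by
    rw [Complex.norm_real, Real.norm_of_nonneg (by positivity)]
  obtain ⟨k, hk⟩ := h ((T ^ m) ω) (fun j => ((S⁻¹ : ℝ) : ℂ) * ψ (j + m))
    (fun j => by
      rw [norm_mul, hSn, ← div_eq_inv_mul, div_le_one h0]
      exact hle _)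
    (by
      rw [norm_mul, hSn, ← div_eq_inv_mul, le_div_iff₀ h0, zero_add]
      linarith)
  rw [jacobiDiff_const_mul _ _ _ _ _ _ (fun j => ψ (j + m)), jacobiDiff_zpow_apply, norm_mul, hSn,
    ← div_eq_inv_mul, lt_div_iff₀ h0] at hk
  calc c * ‖ψ n‖ ≤ c * S := by gcongr; exact hle n
    _ ≤ ε := hk.le.trans (hε _)

theorem abs_pow_sub_pow_le {r : ℝ} (h0 : 0 < r) (h1 : r < 1) {i j : ℕ} (h : i = j + 1 ∨ j = i + 1) :
    |r ^ i - r ^ j| ≤ (1 - r) / r * r ^ i := by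
  rw [div_mul_eq_mul_div, le_div_iff₀ h0]
  have hp : 0 < r ^ i := by positivity
  have hq : 0 < r ^ j := by positivity
  rcases h with rfl | rfl
  · rw [pow_succ, show r ^ j * r - r ^ j = -(r ^ j * (1 - r)) by ring, abs_neg,
      abs_of_nonneg (mul_nonneg hq.le (by linarith))]
    exact le_of_eq (by ring)
  · rw [pow_succ, show r ^ i - r ^ i * r = r ^ i * (1 - r) by ring,
      abs_of_nonneg (mul_nonneg hp.le (by linarith))]
    have : 0 ≤ r ^ i * (1 - r) * (1 - r) := by
      have : 0 ≤ 1 - r := by linarith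
      positivity
    nlinarith

/-- A Combes–Thomas argument: multiplying by `r ^ |n - m|` produces a commutator of size at most `2
‖a‖ (1 - r) / r ≤ c / 2` in the sup norm, which is absorbed at the price of half the constant. -/
theorem mul_norm_le_of_weighted [CompactSpace Ω] {c r : ℝ} (hc : 0 < c) (h0 : 0 < r) (h1 : r < 1)
    (hr : 4 * ‖a‖ * (1 - r) ≤ c * r)
    (h : ∀ ω ψ, (∀ n, ‖ψ n‖ ≤ 1) → 1 / 2 ≤ ‖ψ 0‖ → ∃ n, c < ‖jacobiDiff T a b E ω ψ n‖)
    {ω : Ω} {ψ : ℤ → ℂ} {M ε : ℝ} (hM : ∀ n, ‖ψ n‖ ≤ M) {m : ℤ}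
    (hε : ∀ n, r ^ (n - m).natAbs * ‖jacobiDiff T a b E ω ψ n‖ ≤ ε) : c / 2 * ‖ψ m‖ ≤ ε := by
  let φ : ℤ → ℂ := fun n => ((r ^ (n - m).natAbs : ℝ) : ℂ) * ψ n
  have hφ : ∀ n, ‖φ n‖ = r ^ (n - m).natAbs * ‖ψ n‖ := fun n => by
    rw [norm_mul, Complex.norm_real, Real.norm_of_nonneg (by positivity)]
  have hφM : ∀ n, ‖φ n‖ ≤ M := fun n => by
    rw [hφ]
    exact (mul_le_of_le_one_left (norm_nonneg _) (pow_le_one₀ h0.le h1.le)).trans (hM n)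
  have hbdd : BddAbove (Set.range fun n => ‖φ n‖) := ⟨M, by rintro _ ⟨n, rfl⟩; exact hφM n⟩
  have hle : ∀ n, ‖φ n‖ ≤ ⨆ n, ‖φ n‖ := fun n => le_ciSup hbdd n
  set S := ⨆ n, ‖φ n‖ with hS
  have hcomm : ∀ n k : ℤ, (k = n - 1 ∨ k = n + 1) →
      ‖φ k - ((r ^ (n - m).natAbs : ℝ) : ℂ) * ψ k‖ ≤ (1 - r) / r * S := by
    intro n k hk
    have h2 : φ k - ((r ^ (n - m).natAbs : ℝ) : ℂ) * ψ k =
        ((r ^ (k - m).natAbs - r ^ (n - m).natAbs : ℝ) : ℂ) * ψ k := by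
      simp only [φ]
      push_cast
      ring
    rw [h2, norm_mul, Complex.norm_real, Real.norm_eq_abs]
    have h3 := abs_pow_sub_pow_le h0 h1 (show (k - m).natAbs = (n - m).natAbs + 1 ∨
      (n - m).natAbs = (k - m).natAbs + 1 by omega)
    have h4 : 0 ≤ (1 - r) / r := div_nonneg (by linarith) h0.le
    calc |r ^ (k - m).natAbs - r ^ (n - m).natAbs| * ‖ψ k‖
        ≤ ((1 - r) / r * r ^ (k - m).natAbs) * ‖ψ k‖ := by gcongr
      _ = (1 - r) / r * ‖φ k‖ := by rw [hφ]; ring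
      _ ≤ _ := by gcongr; exact hle k
  have hS0 : 0 ≤ S := (norm_nonneg _).trans (hle 0)
  have hdiff : ∀ n, ‖jacobiDiff T a b E ω φ n‖ ≤ ε + c / 2 * S := by
    intro n
    have h2 : jacobiDiff T a b E ω φ n =
        ((r ^ (n - m).natAbs : ℝ) : ℂ) * jacobiDiff T a b E ω ψ n +
        ((starRingEnd ℂ) (a ((T ^ (n - 1)) ω)) *
          (φ (n - 1) - ((r ^ (n - m).natAbs : ℝ) : ℂ) * ψ (n - 1)) +
        a ((T ^ n) ω) * (φ (n + 1) - ((r ^ (n - m).natAbs : ℝ) : ℂ) * ψ (n + 1))) := by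
      simp only [jacobiDiff, φ]
      ring
    have h3 : ∀ k : ℤ, ‖a ((T ^ k) ω)‖ ≤ ‖a‖ := fun k => a.norm_coe_le_norm _
    have h4 : 2 * ‖a‖ * ((1 - r) / r) ≤ c / 2 := by
      rw [← mul_div_assoc, div_le_iff₀ h0]
      linarith
    rw [h2]
    refine (norm_add_le _ _).trans (add_le_add ?_ ((norm_add_le _ _).trans ?_))
    · rw [norm_mul, Complex.norm_real, Real.norm_of_nonneg (by positivity)]
      exact hε n
    · rw [norm_mul, norm_mul, RCLike.norm_conj]
      calc _ ≤ ‖a‖ * ((1 - r) / r * S) + ‖a‖ * ((1 - r) / r * S) :=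
            add_le_add
              (mul_le_mul (h3 _) (hcomm n _ (Or.inl rfl)) (norm_nonneg _) (norm_nonneg _))
              (mul_le_mul (h3 _) (hcomm n _ (Or.inr rfl)) (norm_nonneg _) (norm_nonneg _))
        _ = (2 * ‖a‖ * ((1 - r) / r)) * S := by ring
        _ ≤ _ := by gcongr
  have h5 : S ≤ (ε + c / 2 * S) / c := ciSup_le fun n => by
    rw [le_div_iff₀' hc]
    exact mul_norm_le_of_norm_jacobiDiff_le hc h hφM hdiff n
  rw [le_div_iff₀' hc] at h5
  have h6 := hle m
  rw [hφ, sub_self, Int.natAbs_zero, pow_zero, one_mul] at h6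
  nlinarith

theorem JacobiSplitting.exists_mul_norm_le [CompactSpace Ω] (D : JacobiSplitting T a b E) (ω : Ω) :
    ∃ c : ℝ, 0 < c ∧ ∀ ψ, c * ‖ψ‖ ≤ ‖jacobiSub T a b E ω ψ‖ := by
  obtain ⟨c, hc, h⟩ := exists_lt_norm_jacobiDiff (T := T) (a := a) (b := b) (E := E)
    fun ω ψ h1 h2 => D.eq_zero_of_bounded h2 h1 0
  have hA : 0 < 4 * (‖a‖ + 1) := by positivity
  obtain ⟨r, hr0, hr1, hr⟩ : ∃ r : ℝ, 0 < r ∧ r < 1 ∧ 4 * ‖a‖ * (1 - r) ≤ c * r := by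
    -- This `r` solves `4 (‖a‖ + 1) (1 - r) = c r`; the summand `1` keeps it positive when `a = 0`.
    refine ⟨4 * (‖a‖ + 1) / (4 * (‖a‖ + 1) + c), by positivity, ?_, ?_⟩
    · rw [div_lt_one (by positivity)]
      linarith
    · rw [one_sub_div (by positivity), mul_div_assoc', mul_div_assoc']
      refine div_le_div_of_nonneg_right ?_ (by positivity)
      nlinarith
  have hQ : 0 < ∑' k : ℤ, (r ^ 2) ^ k.natAbs :=
    (summable_pow_natAbs (by positivity) (by nlinarith)).tsum_pos (fun _ => by positivity) 0
      (by simp)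
  refine ⟨c / 2 / √(∑' k : ℤ, (r ^ 2) ^ k.natAbs), by positivity, fun ψ => ?_⟩
  rw [div_mul_eq_mul_div, div_le_iff₀' (by positivity)]
  refine L2Z.norm_le_of_pointwise (by positivity) hr0 hr1 fun m ε hε => ?_
  refine mul_norm_le_of_weighted hc hr0 hr1 hr h (ω := ω) ψ.norm_apply_le fun n => ?_
  rw [← jacobiSub_apply]
  exact hε n

end LowerBound

/-! ### Translations and restrictions on `ℓ²(ℤ)`. -/

section Shift

/-- The translation `ψ ↦ ψ (· + m)` on `ℓ²(ℤ)`. -/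
noncomputable def L2Z.shift (m : ℤ) : L2Z →L[ℂ] L2Z := weightedShift 1 m

@[simp]
theorem L2Z.shift_apply (m : ℤ) (ψ : L2Z) (n : ℤ) : L2Z.shift m ψ n = ψ (n + m) := by
  rw [L2Z.shift, weightedShift_apply, lp.infty_coeFn_one, Pi.one_apply, one_mul]

theorem L2Z.norm_shift (m : ℤ) (ψ : L2Z) : ‖L2Z.shift m ψ‖ = ‖ψ‖ := by
  have h : ‖L2Z.shift m ψ‖ ^ 2 = ‖ψ‖ ^ 2 := by
    have h1 := (Equiv.addRight m).tsum_eq fun n : ℤ => ‖ψ n‖ ^ 2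
    rw [L2Z.norm_sq_eq_tsum, L2Z.norm_sq_eq_tsum, ← h1]
    simp
  exact (pow_left_inj₀ (norm_nonneg _) (norm_nonneg _) two_ne_zero).1 h

/-- The restriction of a sequence to a set of indices, extended by zero. -/
noncomputable def L2Z.restrict (s : Set ℤ) : L2Z →L[ℂ] L2Z :=
  weightedShift ⟨s.indicator 1, memℓp_infty ⟨1, by
    rintro _ ⟨n, rfl⟩
    by_cases h : n ∈ s <;> simp [h]⟩⟩ 0

theorem L2Z.restrict_apply_mem {s : Set ℤ} (ψ : L2Z) {n : ℤ} (h : n ∈ s) :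
    L2Z.restrict s ψ n = ψ n := by
  simp [L2Z.restrict, h]

theorem L2Z.restrict_apply_notMem {s : Set ℤ} (ψ : L2Z) {n : ℤ} (h : n ∉ s) :
    L2Z.restrict s ψ n = 0 := by
  simp [L2Z.restrict, h]

theorem L2Z.tendsto_norm_apply (ψ : L2Z) : Tendsto (fun n => ‖ψ n‖) cofinite (𝓝 0) := by
  have h := ψ.summable_norm_sq.tendsto_cofinite_zero.sqrt
  simpa using h

end Shift

/-! ### Strong continuity in `ω` and the lower bound on all of `Ω`. -/

section UniformBound

variable {Ω : Type*} [MetricSpace Ω] [CompactSpace Ω] {T : Ω ≃ₜ Ω} {a : C(Ω, ℂ)} {b : C(Ω, ℝ)}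
  {E : ℂ}

/-- Each coefficient is continuous in `ω`, and the squared differences are dominated by `(2 ‖f‖)² ‖ψ
(n + k)‖²`. Only strong continuity is obtained, which suffices for fixed `ψ`. -/
theorem continuous_weightedShift_sample (T : Ω ≃ₜ Ω) (f : C(Ω, ℂ)) (k : ℤ) (ψ : L2Z) :
    Continuous fun ω => weightedShift (sample T f ω) k ψ := by
  refine continuous_iff_continuousAt.2 fun ω => ?_
  rw [ContinuousAt, tendsto_iff_norm_sub_tendsto_zero]
  have hn : ∀ ω', ‖weightedShift (sample T f ω') k ψ - weightedShift (sample T f ω) k ψ‖ ^ 2 =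
      ∑' n : ℤ, ‖(f ((T ^ n) ω') - f ((T ^ n) ω)) * ψ (n + k)‖ ^ 2 := fun ω' => by
    rw [L2Z.norm_sq_eq_tsum]
    refine tsum_congr fun n => ?_
    rw [sub_mul]
    rfl
  have h : Tendsto (fun ω' => ∑' n : ℤ, ‖(f ((T ^ n) ω') - f ((T ^ n) ω)) * ψ (n + k)‖ ^ 2) (𝓝 ω)
      (𝓝 (∑' _ : ℤ, 0)) := by
    refine tendsto_tsum_of_dominated_convergence
      (bound := fun n => (2 * ‖f‖) ^ 2 * ‖L2Z.shift k ψ n‖ ^ 2)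
      ((L2Z.summable_norm_sq _).mul_left _) (fun n => ?_) (Eventually.of_forall fun ω' n => ?_)
    · have hc : Continuous fun ω' => ‖(f ((T ^ n) ω') - f ((T ^ n) ω)) * ψ (n + k)‖ ^ 2 := by
        have := f.continuous.comp (T ^ n).continuous
        exact (((this.sub continuous_const).mul continuous_const).norm).pow 2
      simpa using hc.tendsto ω
    · rw [Real.norm_of_nonneg (by positivity), norm_mul, mul_pow, L2Z.shift_apply]
      have h1 : ‖f ((T ^ n) ω') - f ((T ^ n) ω)‖ ≤ 2 * ‖f‖ := by
        refine (norm_sub_le _ _).trans ?_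
        linarith [f.norm_coe_le_norm ((T ^ n) ω'), f.norm_coe_le_norm ((T ^ n) ω)]
      gcongr
  simp only [← hn, tsum_zero] at h
  simpa using h.sqrt

theorem continuous_jacobiSub (T : Ω ≃ₜ Ω) (a : C(Ω, ℂ)) (b : C(Ω, ℝ)) (E : ℂ) (ψ : L2Z) :
    Continuous fun ω => jacobiSub T a b E ω ψ := by
  simp only [jacobiSub, jacobiOperator, add_apply, sub_apply]
  exact (((continuous_weightedShift_sample T _ _ ψ).add
    (continuous_weightedShift_sample T _ _ ψ)).add
    (continuous_weightedShift_sample T _ _ ψ)).sub continuous_const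

theorem jacobiSub_shift (ω : Ω) (m : ℤ) (ψ : L2Z) :
    jacobiSub T a b E ((T ^ m) ω) (L2Z.shift m ψ) = L2Z.shift m (jacobiSub T a b E ω ψ) := by
  ext n
  rw [jacobiSub_apply, L2Z.shift_apply, jacobiSub_apply, ← jacobiDiff_zpow_apply]
  congr 1
  ext j
  exact L2Z.shift_apply m ψ j

/-- A lower bound at a point with dense orbit extends to the whole space. -/
theorem forall_mul_norm_le_of_dense {c : ℝ} {ω₀ : Ω}
    (hω₀ : closure (Set.range fun n : ℤ => (T ^ n) ω₀) = Set.univ)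
    (h : ∀ ψ, c * ‖ψ‖ ≤ ‖jacobiSub T a b E ω₀ ψ‖) (ω : Ω) (ψ : L2Z) :
    c * ‖ψ‖ ≤ ‖jacobiSub T a b E ω ψ‖ := by
  have hclosed : IsClosed {ω | c * ‖ψ‖ ≤ ‖jacobiSub T a b E ω ψ‖} :=
    isClosed_le continuous_const (continuous_jacobiSub T a b E ψ).norm
  have hsub : Set.range (fun n : ℤ => (T ^ n) ω₀) ⊆
      {ω | c * ‖ψ‖ ≤ ‖jacobiSub T a b E ω ψ‖} := by
    rintro _ ⟨n, rfl⟩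
    have h1 : ψ = L2Z.shift n (L2Z.shift (-n) ψ) := by
      ext j
      simp
    have h2 := h (L2Z.shift (-n) ψ)
    rw [L2Z.norm_shift, ← L2Z.norm_shift n (jacobiSub T a b E ω₀ _), ← jacobiSub_shift, ← h1] at h2
    exact h2
  have := closure_minimal hsub hclosed
  rw [hω₀] at this
  exact this (Set.mem_univ ω)

theorem exists_jacobiSub_eq {c : ℝ} (hc : 0 < c) {ω : Ω}
    (h : ∀ ψ, c * ‖ψ‖ ≤ ‖jacobiSub T a b E ω ψ‖) (f : L2Z) : ∃ x, jacobiSub T a b E ω x = f :=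
  (ContinuousLinearMap.isUnit_iff_bijective.1
    ((isStarNormal_jacobiSub T a b E ω).isUnit_of_bounded_below hc h)).2 f

/-- Solutions of `(J_ω - E) x = f` depend continuously on `ω`. -/
theorem continuous_of_jacobiSub_eq {c : ℝ} (hc : 0 < c)
    (h : ∀ ω ψ, c * ‖ψ‖ ≤ ‖jacobiSub T a b E ω ψ‖) {x f : Ω → L2Z} (hf : Continuous f)
    (hx : ∀ ω, jacobiSub T a b E ω (x ω) = f ω) : Continuous x := by
  refine continuous_iff_continuousAt.2 fun ω => ?_
  rw [ContinuousAt, tendsto_iff_norm_sub_tendsto_zero]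
  have h1 : Tendsto (fun ω' => c⁻¹ * ‖f ω' - jacobiSub T a b E ω' (x ω)‖) (𝓝 ω) (𝓝 0) := by
    have h2 : Continuous fun ω' => c⁻¹ * ‖f ω' - jacobiSub T a b E ω' (x ω)‖ :=
      continuous_const.mul (hf.sub (continuous_jacobiSub T a b E (x ω))).norm
    simpa [hx] using h2.tendsto ω
  refine squeeze_zero (fun _ => norm_nonneg _) (fun ω' => ?_) h1
  rw [← div_eq_inv_mul, le_div_iff₀' hc, ← hx ω', ← map_sub]
  exact h ω' _

end UniformBound

/-- The sequence with the single entry `z` at `n`. -/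
noncomputable def L2Z.delta (n : ℤ) (z : ℂ) : L2Z := lp.single 2 n z

theorem L2Z.delta_apply (n : ℤ) (z : ℂ) (j : ℤ) : L2Z.delta n z j = if j = n then z else 0 := by
  rw [L2Z.delta, lp.single_apply, Pi.single_apply]

theorem L2Z.norm_delta (n : ℤ) (z : ℂ) : ‖L2Z.delta n z‖ = ‖z‖ := by
  rw [L2Z.delta, lp.norm_single (by norm_num)]

theorem L2Z.continuous_delta (n : ℤ) : Continuous (L2Z.delta n) := by
  have h : Isometry (lp.single (E := fun _ : ℤ => ℂ) 2 n) := lp.isometry_single n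
  exact h.continuous

/-! ### Truncated solutions and their boundary sources. -/

section Tails

variable {Ω : Type*} [MetricSpace Ω] {T : Ω ≃ₜ Ω} {a : C(Ω, ℂ)} {b : C(Ω, ℝ)}
  {E : ℂ}

/-- The image under `J_ω - E` of the part in `[m, ∞)` of a sequence `ψ` that solves the equation
there, where `ψ m = p` and `ψ (m - 1) = q`. -/
noncomputable def cutSource (T : Ω ≃ₜ Ω) (a : C(Ω, ℂ)) (ω : Ω) (m : ℤ) (p q : ℂ) : L2Z :=
  L2Z.delta (m - 1) (a ((T ^ (m - 1)) ω) * p) -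
    L2Z.delta m ((starRingEnd ℂ) (a ((T ^ (m - 1)) ω)) * q)

theorem cutSource_apply (ω : Ω) (m : ℤ) (p q : ℂ) (n : ℤ) :
    cutSource T a ω m p q n = (if n = m - 1 then a ((T ^ (m - 1)) ω) * p else 0) -
      if n = m then (starRingEnd ℂ) (a ((T ^ (m - 1)) ω)) * q else 0 := by
  rw [← L2Z.delta_apply, ← L2Z.delta_apply]
  rfl

theorem norm_cutSource_le (ω : Ω) (m : ℤ) (p q : ℂ) :
    ‖cutSource T a ω m p q‖ ≤ ‖a ((T ^ (m - 1)) ω) * p‖ + ‖a ((T ^ (m - 1)) ω) * q‖ := by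
  refine (norm_sub_le _ _).trans_eq ?_
  rw [L2Z.norm_delta, L2Z.norm_delta, norm_mul (starRingEnd ℂ _), RCLike.norm_conj, norm_mul _ q]

theorem continuous_cutSource (T : Ω ≃ₜ Ω) (a : C(Ω, ℂ)) (m : ℤ) (p q : ℂ) :
    Continuous fun ω => cutSource T a ω m p q := by
  have h : Continuous fun ω => a ((T ^ (m - 1)) ω) := a.continuous.comp (T ^ (m - 1)).continuous
  exact ((L2Z.continuous_delta _).comp (h.mul continuous_const)).sub
    ((L2Z.continuous_delta _).comp ((Complex.continuous_conj.comp h).mul continuous_const))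

variable [CompactSpace Ω]

theorem jacobiSub_restrict_Ici {ω : Ω} {m : ℤ} {ψ : L2Z}
    (h : ∀ n, m ≤ n → jacobiDiff T a b E ω ψ n = 0) :
    jacobiSub T a b E ω (L2Z.restrict (Set.Ici m) ψ) = cutSource T a ω m (ψ m) (ψ (m - 1)) := by
  have h1 : ∀ j, m ≤ j → L2Z.restrict (Set.Ici m) ψ j = ψ j := fun j hj =>
    L2Z.restrict_apply_mem ψ (Set.mem_Ici.2 hj)
  have h2 : ∀ j, j < m → L2Z.restrict (Set.Ici m) ψ j = 0 := fun j hj =>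
    L2Z.restrict_apply_notMem ψ (by simpa using hj)
  ext n
  rw [jacobiSub_apply, cutSource_apply]
  rcases lt_trichotomy n (m - 1) with hn | rfl | hn
  · rw [jacobiDiff, h2 _ (by omega), h2 _ (by omega), h2 _ (by omega), if_neg (by omega),
      if_neg (by omega)]
    simp
  · rw [jacobiDiff, h2 _ (by omega), h2 (m - 1) (by omega), h1 _ (by omega), if_pos rfl,
      if_neg (by omega), sub_add_cancel]
    simp
  · rcases (show m ≤ n by omega).eq_or_lt with rfl | hn'
    · have h3 := h m le_rfl
      rw [jacobiDiff] at h3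
      rw [jacobiDiff, h2 _ (by omega), h1 _ (by omega), h1 _ le_rfl, if_neg (by omega), if_pos rfl]
      linear_combination h3
    · rw [if_neg (by omega), if_neg (by omega), sub_zero, ← h n (by omega), jacobiDiff, jacobiDiff,
        h1 _ (by omega), h1 _ (by omega), h1 _ (by omega)]

theorem jacobiSub_restrict_Iio {ω : Ω} {m : ℤ} {ψ : L2Z}
    (h : ∀ n, n < m → jacobiDiff T a b E ω ψ n = 0) :
    jacobiSub T a b E ω (L2Z.restrict (Set.Iio m) ψ) = -cutSource T a ω m (ψ m) (ψ (m - 1)) := by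
  have h1 : ∀ j, j < m → L2Z.restrict (Set.Iio m) ψ j = ψ j := fun j hj =>
    L2Z.restrict_apply_mem ψ (Set.mem_Iio.2 hj)
  have h2 : ∀ j, m ≤ j → L2Z.restrict (Set.Iio m) ψ j = 0 := fun j hj =>
    L2Z.restrict_apply_notMem ψ (by simpa using hj)
  ext n
  have hneg : (-cutSource T a ω m (ψ m) (ψ (m - 1))) n =
    -(cutSource T a ω m (ψ m) (ψ (m - 1)) n) := rfl
  rw [jacobiSub_apply, hneg, cutSource_apply]
  rcases lt_trichotomy n (m - 1) with hn | rfl | hn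
  · rw [if_neg (by omega), if_neg (by omega), sub_zero, neg_zero, ← h n (by omega), jacobiDiff,
      jacobiDiff, h1 _ (by omega), h1 _ (by omega), h1 _ (by omega)]
  · have h3 := h (m - 1) (by omega)
    rw [jacobiDiff, sub_add_cancel] at h3
    rw [jacobiDiff, sub_add_cancel, h1 _ (by omega), h1 (m - 1) (by omega), h2 _ le_rfl,
      if_pos rfl, if_neg (by omega)]
    linear_combination h3
  · rcases (show m ≤ n by omega).eq_or_lt with rfl | hn'
    · rw [jacobiDiff, h1 _ (by omega), h2 _ le_rfl, h2 _ (by omega), if_neg (by omega), if_pos rfl]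
      ring
    · rw [jacobiDiff, h2 _ (by omega), h2 _ (by omega), h2 _ (by omega), if_neg (by omega),
        if_neg (by omega)]
      simp

/-- A truncated solution fails the equation only at `m - 1` and `m`, each time with a factor `a
(T^(m-1) ω)` up to conjugation. The whole tail is thus controlled by two boundary values, and
vanishes when this coefficient is zero. -/
theorem mul_norm_restrict_Ici_le {c : ℝ} {ω : Ω}
    (hc : ∀ ψ, c * ‖ψ‖ ≤ ‖jacobiSub T a b E ω ψ‖) {m : ℤ} {ψ : L2Z}
    (h : ∀ n, m ≤ n → jacobiDiff T a b E ω ψ n = 0) :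
    c * ‖L2Z.restrict (Set.Ici m) ψ‖ ≤
      ‖a ((T ^ (m - 1)) ω) * ψ m‖ + ‖a ((T ^ (m - 1)) ω) * ψ (m - 1)‖ := by
  refine (hc _).trans ?_
  rw [jacobiSub_restrict_Ici h]
  exact norm_cutSource_le _ _ _ _

theorem mul_norm_restrict_Iio_le {c : ℝ} {ω : Ω}
    (hc : ∀ ψ, c * ‖ψ‖ ≤ ‖jacobiSub T a b E ω ψ‖) {m : ℤ} {ψ : L2Z}
    (h : ∀ n, n < m → jacobiDiff T a b E ω ψ n = 0) :
    c * ‖L2Z.restrict (Set.Iio m) ψ‖ ≤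
      ‖a ((T ^ (m - 1)) ω) * ψ m‖ + ‖a ((T ^ (m - 1)) ω) * ψ (m - 1)‖ := by
  refine (hc _).trans ?_
  rw [jacobiSub_restrict_Iio h, norm_neg]
  exact norm_cutSource_le _ _ _ _

end Tails

/-! ### The Wronskian of two solutions. -/

section Wronskian

variable {Ω : Type*} [MetricSpace Ω] {T : Ω ≃ₜ Ω} {a : C(Ω, ℂ)} {b : C(Ω, ℝ)} {E : ℂ}

/-- The modulus of the Wronskian of two sequences. -/
noncomputable def normWronskian (T : Ω ≃ₜ Ω) (a : C(Ω, ℂ)) (ω : Ω) (ψ φ : ℤ → ℂ) (n : ℤ) : ℝ :=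
  ‖a ((T ^ (n - 1)) ω) * (ψ n * φ (n - 1) - ψ (n - 1) * φ n)‖

/-- Passing one site replaces `a` by its conjugate at the other end, so only the modulus is
conserved. -/
theorem normWronskian_succ {ω : Ω} {ψ φ : ℤ → ℂ} {n : ℤ} (hψ : jacobiDiff T a b E ω ψ n = 0)
    (hφ : jacobiDiff T a b E ω φ n = 0) :
    normWronskian T a ω ψ φ (n + 1) = normWronskian T a ω ψ φ n := by
  rw [jacobiDiff] at hψ hφ
  have h : a ((T ^ n) ω) * (ψ (n + 1) * φ n - ψ n * φ (n + 1)) =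
      (starRingEnd ℂ) (a ((T ^ (n - 1)) ω)) * (ψ n * φ (n - 1) - ψ (n - 1) * φ n) := by
    linear_combination φ n * hψ - ψ n * hφ
  rw [normWronskian, normWronskian, add_sub_cancel_right, h, norm_mul, norm_mul, RCLike.norm_conj]

theorem tendsto_normWronskian [CompactSpace Ω] (ω : Ω) (ψ φ : L2Z) :
    Tendsto (normWronskian T a ω ψ φ) cofinite (𝓝 0) := by
  have h1 : Tendsto (fun n => ‖a‖ * (‖ψ n‖ * ‖φ‖ + ‖ψ‖ * ‖φ n‖)) cofinite (𝓝 0) := by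
    have := ((ψ.tendsto_norm_apply.mul_const ‖φ‖).add
      (φ.tendsto_norm_apply.const_mul ‖ψ‖)).const_mul ‖a‖
    simpa using this
  refine squeeze_zero (fun _ => norm_nonneg _) (fun n => ?_) h1
  rw [normWronskian, norm_mul]
  refine mul_le_mul (a.norm_coe_le_norm _) ((norm_sub_le _ _).trans ?_) (norm_nonneg _)
    (norm_nonneg _)
  rw [norm_mul, norm_mul]
  gcongr
  · exact φ.norm_apply_le _
  · exact ψ.norm_apply_le _

theorem normWronskian_zero_eq_zero_of_nonneg [CompactSpace Ω] {ω : Ω} {ψ φ : L2Z}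
    (hψ : ∀ n, 0 ≤ n → jacobiDiff T a b E ω ψ n = 0)
    (hφ : ∀ n, 0 ≤ n → jacobiDiff T a b E ω φ n = 0) : normWronskian T a ω ψ φ 0 = 0 := by
  have h : ∀ n : ℕ, normWronskian T a ω ψ φ n = normWronskian T a ω ψ φ 0 := by
    intro n
    induction n with
    | zero => simp
    | succ n ih =>
      rw [Nat.cast_succ, normWronskian_succ (hψ n (by positivity)) (hφ n (by positivity)), ih]
  have h1 := (tendsto_normWronskian (T := T) (a := a) ω ψ φ).comp
    (Nat.cast_injective (R := ℤ)).tendsto_cofinite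
  rw [Nat.cofinite_eq_atTop] at h1
  refine tendsto_nhds_unique (tendsto_const_nhds (f := atTop (α := ℕ))) (h1.congr fun n => ?_)
  exact h n

theorem normWronskian_zero_eq_zero_of_neg [CompactSpace Ω] {ω : Ω} {ψ φ : L2Z}
    (hψ : ∀ n, n < 0 → jacobiDiff T a b E ω ψ n = 0)
    (hφ : ∀ n, n < 0 → jacobiDiff T a b E ω φ n = 0) : normWronskian T a ω ψ φ 0 = 0 := by
  have h : ∀ n : ℕ, normWronskian T a ω ψ φ (-(n : ℤ)) = normWronskian T a ω ψ φ 0 := by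
    intro n
    induction n with
    | zero => simp
    | succ n ih =>
      rw [← ih, ← normWronskian_succ (hψ (-((n + 1 : ℕ) : ℤ)) (by omega)) (hφ _ (by omega))]
      congr 1
      push_cast
      ring
  have h1 := (tendsto_normWronskian (T := T) (a := a) ω ψ φ).comp
    (neg_injective.comp (Nat.cast_injective (R := ℤ))).tendsto_cofinite
  rw [Nat.cofinite_eq_atTop] at h1
  refine tendsto_nhds_unique (tendsto_const_nhds (f := atTop (α := ℕ))) (h1.congr fun n => ?_)
  exact h n

end Wronskian

/-! ### Data of half-line solutions: invariance, dimension, continuity, injectivity. -/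

section SolutionSpace

variable {Ω : Type*} [MetricSpace Ω]

theorem jacobiDiff_add (T : Ω ≃ₜ Ω) (a : C(Ω, ℂ)) (b : C(Ω, ℝ)) (E : ℂ) (ω : Ω) (ψ φ : L2Z)
    (n : ℤ) : jacobiDiff T a b E ω (ψ + φ : L2Z) n =
      jacobiDiff T a b E ω ψ n + jacobiDiff T a b E ω φ n := by
  simp only [jacobiDiff, lp.coeFn_add, Pi.add_apply]
  ring

theorem jacobiDiff_sub (T : Ω ≃ₜ Ω) (a : C(Ω, ℂ)) (b : C(Ω, ℝ)) (E : ℂ) (ω : Ω) (ψ φ : L2Z)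
    (n : ℤ) : jacobiDiff T a b E ω (ψ - φ : L2Z) n =
      jacobiDiff T a b E ω ψ n - jacobiDiff T a b E ω φ n := by
  simp only [jacobiDiff, lp.coeFn_sub, Pi.sub_apply]
  ring

theorem jacobiDiff_smul (T : Ω ≃ₜ Ω) (a : C(Ω, ℂ)) (b : C(Ω, ℝ)) (E : ℂ) (ω : Ω) (z : ℂ) (ψ : L2Z)
    (n : ℤ) : jacobiDiff T a b E ω (z • ψ : L2Z) n = z * jacobiDiff T a b E ω ψ n := by
  simp only [jacobiDiff, lp.coeFn_smul, Pi.smul_apply, smul_eq_mul]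
  ring

/-- The initial data `(ψ 0, ψ (-1))` of the square-summable sequences `ψ` that solve
`(J_ω - E) ψ = 0` on the set `S`. -/
noncomputable def solutionSpace (T : Ω ≃ₜ Ω) (a : C(Ω, ℂ)) (b : C(Ω, ℝ)) (E : ℂ) (S : Set ℤ)
    (ω : Ω) : Submodule ℂ (EuclideanSpace ℂ (Fin 2)) where
  carrier := {v | ∃ ψ : L2Z, v = !₂[ψ 0, ψ (-1)] ∧ ∀ n ∈ S, jacobiDiff T a b E ω ψ n = 0}
  add_mem' := by
    rintro _ _ ⟨ψ, rfl, hψ⟩ ⟨φ, rfl, hφ⟩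
    refine ⟨ψ + φ, ?_, fun n hn => by rw [jacobiDiff_add, hψ n hn, hφ n hn, add_zero]⟩
    ext i
    fin_cases i <;> simp
  zero_mem' := by
    refine ⟨0, ?_, fun n _ => by simp [jacobiDiff]⟩
    ext i
    fin_cases i <;> simp
  smul_mem' := by
    rintro z _ ⟨ψ, rfl, hψ⟩
    refine ⟨z • ψ, ?_, fun n hn => by rw [jacobiDiff_smul, hψ n hn, mul_zero]⟩
    ext i
    fin_cases i <;> simp

variable {T : Ω ≃ₜ Ω} {a : C(Ω, ℂ)} {b : C(Ω, ℝ)} {E : ℂ}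

theorem cocycleStep_mem_solutionSpace_Ici {ω : Ω} {v : EuclideanSpace ℂ (Fin 2)}
    (hv : v ∈ solutionSpace T a b E (Set.Ici 0) ω) :
    cocycleStep T a b E ω v ∈ solutionSpace T a b E (Set.Ici 0) (T ω) := by
  obtain ⟨ψ, rfl, hψ⟩ := hv
  have h1 := cocycleStep_pair_eq T a b E ω 0 ψ (hψ 0 (by simp))
  simp only [zpow_zero, zero_sub, zero_add] at h1
  have h2 : (1 : Ω ≃ₜ Ω) ω = ω := rfl
  rw [h2] at h1
  rw [h1]
  refine Submodule.smul_mem _ _ ⟨L2Z.shift 1 ψ, by simp, fun n hn => ?_⟩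
  rw [Set.mem_Ici] at hn
  have h3 := jacobiDiff_zpow_apply T a b E ω ψ 1 n
  rw [zpow_one] at h3
  rw [← hψ (n + 1) (by simp; omega), ← h3]
  congr 1
  ext j
  exact L2Z.shift_apply 1 ψ j

/-- A solution on a left half-line can be continued by one step, after multiplication by the
off-diagonal entry. -/
theorem exists_extension {ω : Ω} {n : ℤ} {ψ : L2Z}
    (hψ : ∀ j, j < n → jacobiDiff T a b E ω ψ j = 0) :
    ∃ y : L2Z, (∀ j, j < n + 1 → jacobiDiff T a b E ω y j = 0) ∧
      cocycleStep T a b E ((T ^ n) ω) !₂[ψ n, ψ (n - 1)] = !₂[y (n + 1), y n] ∧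
      ∀ j, j ≤ n → y j = a ((T ^ n) ω) * ψ j := by
  set z := (E - b ((T ^ n) ω)) * ψ n - (starRingEnd ℂ) (a ((T ^ (n - 1)) ω)) * ψ (n - 1) with hz
  let y : L2Z := a ((T ^ n) ω) • ψ + L2Z.delta (n + 1) (z - a ((T ^ n) ω) * ψ (n + 1))
  have hy : ∀ j, y j = a ((T ^ n) ω) * ψ j +
      if j = n + 1 then z - a ((T ^ n) ω) * ψ (n + 1) else 0 := fun j => by
    rw [← L2Z.delta_apply]
    rfl
  have hy1 : y (n + 1) = z := by rw [hy, if_pos rfl]; ring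
  have hy2 : ∀ j, j ≤ n → y j = a ((T ^ n) ω) * ψ j := fun j hj => by
    rw [hy, if_neg (by omega), add_zero]
  refine ⟨y, fun j hj => ?_, ?_, hy2⟩
  · rcases (show j ≤ n by omega).eq_or_lt with rfl | hj'
    · rw [jacobiDiff, hy1, hy2 _ le_rfl, hy2 _ (by omega), hz]
      ring
    · have h1 := hψ j hj'
      rw [jacobiDiff] at h1 ⊢
      rw [hy2 _ (by omega), hy2 _ (by omega), hy2 _ (by omega)]
      linear_combination a ((T ^ n) ω) * h1
  · rw [cocycleStep_apply, hy1, hy2 n le_rfl]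
    simp [hz]

theorem cocycleStep_mem_solutionSpace_Iio {ω : Ω} {v : EuclideanSpace ℂ (Fin 2)}
    (hv : v ∈ solutionSpace T a b E (Set.Iio 0) ω) :
    cocycleStep T a b E ω v ∈ solutionSpace T a b E (Set.Iio 0) (T ω) := by
  obtain ⟨ψ, rfl, hψ⟩ := hv
  obtain ⟨y, hy, h1, -⟩ := exists_extension (n := 0) hψ
  have h2 : (1 : Ω ≃ₜ Ω) ω = ω := rfl
  simp only [zpow_zero, zero_sub, zero_add, h2] at h1
  rw [h1]
  refine ⟨L2Z.shift 1 y, by simp, fun n hn => ?_⟩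
  rw [Set.mem_Iio] at hn
  have h3 := jacobiDiff_zpow_apply T a b E ω y 1 n
  rw [zpow_one] at h3
  rw [← hy (n + 1) (by omega), ← h3]
  congr 1
  ext j
  exact L2Z.shift_apply 1 y j

variable [CompactSpace Ω] {c : ℝ}

/-- The space is at most one-dimensional. The Wronskian is constant and tends to `0`, which decides
the case `a (T⁻¹ ω) ≠ 0`; otherwise the tail bound forces `ψ 0 = 0`. -/
theorem cross_eq_zero_of_mem_solutionSpace_Ici (hc : 0 < c) {ω : Ω}
    (h : ∀ ψ, c * ‖ψ‖ ≤ ‖jacobiSub T a b E ω ψ‖) {v w : EuclideanSpace ℂ (Fin 2)}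
    (hv : v ∈ solutionSpace T a b E (Set.Ici 0) ω)
    (hw : w ∈ solutionSpace T a b E (Set.Ici 0) ω) : cross v w = 0 := by
  obtain ⟨ψ, rfl, hψ⟩ := hv
  obtain ⟨φ, rfl, hφ⟩ := hw
  by_cases ha : a ((T ^ (-1 : ℤ)) ω) = 0
  · have key : ∀ ψ : L2Z, (∀ n ∈ Set.Ici (0 : ℤ), jacobiDiff T a b E ω ψ n = 0) → ψ 0 = 0 := by
      intro ψ hψ
      have h1 := mul_norm_restrict_Ici_le h hψ
      rw [zero_sub, ha, zero_mul, zero_mul, norm_zero, add_zero] at h1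
      have h2 := norm_le_zero_iff.1 (nonpos_of_mul_nonpos_right h1 hc)
      rw [← L2Z.restrict_apply_mem ψ (Set.self_mem_Ici (a := (0 : ℤ))), h2]
      rfl
    simp [cross, key ψ hψ, key φ hφ]
  · have h1 := normWronskian_zero_eq_zero_of_nonneg hψ hφ
    rw [normWronskian, norm_eq_zero, zero_sub] at h1
    simpa [cross] using (mul_eq_zero.1 h1).resolve_left ha

theorem cross_eq_zero_of_mem_solutionSpace_Iio (hc : 0 < c) {ω : Ω}
    (h : ∀ ψ, c * ‖ψ‖ ≤ ‖jacobiSub T a b E ω ψ‖) {v w : EuclideanSpace ℂ (Fin 2)}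
    (hv : v ∈ solutionSpace T a b E (Set.Iio 0) ω)
    (hw : w ∈ solutionSpace T a b E (Set.Iio 0) ω) : cross v w = 0 := by
  obtain ⟨ψ, rfl, hψ⟩ := hv
  obtain ⟨φ, rfl, hφ⟩ := hw
  by_cases ha : a ((T ^ (-1 : ℤ)) ω) = 0
  · have key : ∀ ψ : L2Z, (∀ n ∈ Set.Iio (0 : ℤ), jacobiDiff T a b E ω ψ n = 0) →
        ψ (-1) = 0 := by
      intro ψ hψ
      have h1 := mul_norm_restrict_Iio_le h hψ
      rw [zero_sub, ha, zero_mul, zero_mul, norm_zero, add_zero] at h1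
      have h2 := norm_le_zero_iff.1 (nonpos_of_mul_nonpos_right h1 hc)
      rw [← L2Z.restrict_apply_mem ψ (show (-1 : ℤ) ∈ Set.Iio 0 by simp), h2]
      rfl
    simp [cross, key ψ hψ, key φ hφ]
  · have h1 := normWronskian_zero_eq_zero_of_neg hψ hφ
    rw [normWronskian, norm_eq_zero, zero_sub] at h1
    simpa [cross] using (mul_eq_zero.1 h1).resolve_left ha

/-- Every vector splits, continuously in `ω`, into initial data of solutions on the two
half-lines. -/
theorem exists_continuous_splitting (hc : 0 < c)
    (h : ∀ ω ψ, c * ‖ψ‖ ≤ ‖jacobiSub T a b E ω ψ‖) (v : EuclideanSpace ℂ (Fin 2)) :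
    ∃ σ : Ω → EuclideanSpace ℂ (Fin 2), Continuous σ ∧
      (∀ ω, σ ω ∈ solutionSpace T a b E (Set.Ici 0) ω) ∧
      ∀ ω, v - σ ω ∈ solutionSpace T a b E (Set.Iio 0) ω := by
  -- The source is that of a solution with data `v` cut at `0`. Then `x + δ₋₁ v₁` solves on the
  -- right and `δ₀ v₀ - x` on the left, and their data add up to `v`.
  choose x hx using fun ω => exists_jacobiSub_eq hc (h ω) (cutSource T a ω 0 (v 0) (v 1))
  have hxc := continuous_of_jacobiSub_eq hc h (continuous_cutSource T a 0 (v 0) (v 1)) hx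
  have hev : ∀ n : ℤ, Continuous fun ω => x ω n := fun n =>
    (lp.evalCLM ℂ (fun _ : ℤ => ℂ) 2 n).continuous.comp hxc
  have hx' : ∀ ω n, jacobiDiff T a b E ω (x ω) n = _ := fun ω n => by
    rw [← jacobiSub_apply, hx, cutSource_apply]
  refine ⟨fun ω => !₂[x ω 0, x ω (-1) + v 1], ?_, fun ω => ?_, fun ω => ?_⟩
  · refine (PiLp.continuous_toLp 2 _).comp (continuous_pi fun i => ?_)
    fin_cases i
    · exact hev 0
    · exact (hev (-1)).add continuous_const
  · refine ⟨x ω + L2Z.delta (-1) (v 1), ?_, fun n hn => ?_⟩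
    · ext i
      fin_cases i <;> simp [L2Z.delta_apply]
    · rw [Set.mem_Ici] at hn
      rw [jacobiDiff_add, hx', jacobiDiff, L2Z.delta_apply, L2Z.delta_apply, L2Z.delta_apply,
        if_neg (show n ≠ 0 - 1 by omega), if_neg (show n ≠ -1 by omega),
        if_neg (show n + 1 ≠ -1 by omega)]
      by_cases h0 : n = 0
      · subst h0
        simp
      · simp [h0, show n - 1 ≠ -1 by omega]
  · refine ⟨L2Z.delta 0 (v 0) - x ω, ?_, fun n hn => ?_⟩
    · ext i
      fin_cases i <;> simp [L2Z.delta_apply]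
    · rw [Set.mem_Iio] at hn
      rw [jacobiDiff_sub, hx', jacobiDiff, L2Z.delta_apply, L2Z.delta_apply, L2Z.delta_apply,
        if_neg (show n ≠ 0 by omega), if_neg (show n - 1 ≠ 0 by omega)]
      by_cases h0 : n = -1
      · subst h0
        simp
      · simp [h0, hn.ne, show n + 1 ≠ 0 by omega]

/-- If `B v = 0`, the left solution can be continued by the value `0` at `1`. Both boundary terms
`a(ω) φ 1` and `a(ω) φ 0` vanish, and the tail bound gives zero. -/
theorem eq_zero_of_cocycleStep_eq_zero (hc : 0 < c) {ω : Ω}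
    (h : ∀ ψ, c * ‖ψ‖ ≤ ‖jacobiSub T a b E ω ψ‖) {v : EuclideanSpace ℂ (Fin 2)}
    (hv : v ∈ solutionSpace T a b E (Set.Iio 0) ω) (h0 : cocycleStep T a b E ω v = 0) :
    v = 0 := by
  obtain ⟨ψ, rfl, hψ⟩ := hv
  have h1 := cocycleStep_apply T a b E ω 0 !₂[ψ 0, ψ (-1)]
  have h2 : (1 : Ω ≃ₜ Ω) ω = ω := rfl
  simp only [zpow_zero, h2, h0, zero_sub] at h1
  have e0 := congrArg (fun v : EuclideanSpace ℂ (Fin 2) => v 0) h1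
  have e1 := congrArg (fun v : EuclideanSpace ℂ (Fin 2) => v 1) h1
  simp only [PiLp.zero_apply, Matrix.cons_val_zero, Matrix.cons_val_one] at e0 e1
  let φ : L2Z := ψ - L2Z.delta 1 (ψ 1)
  have hφ : ∀ j, φ j = ψ j - if j = 1 then ψ 1 else 0 := fun j => by
    rw [← L2Z.delta_apply]
    rfl
  have hφ1 : φ 1 = 0 := by rw [hφ, if_pos rfl, sub_self]
  have hφ2 : ∀ j, j < 1 → φ j = ψ j := fun j hj => by rw [hφ, if_neg (by omega), sub_zero]
  have hsol : ∀ n, n < 1 → jacobiDiff T a b E ω φ n = 0 := by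
    intro n hn
    rcases (show n ≤ 0 by omega).eq_or_lt with rfl | hn'
    · rw [jacobiDiff, zero_add, zero_sub, hφ1, hφ2 _ (by omega), hφ2 _ (by omega), zpow_zero, h2]
      linear_combination e0
    · rw [← hψ n hn', jacobiDiff, jacobiDiff, hφ2 _ (by omega), hφ2 _ (by omega), hφ2 _ (by omega)]
  have h3 := mul_norm_restrict_Iio_le h hsol
  rw [hφ1, sub_self, zpow_zero, h2, hφ2 0 (by omega), ← e1, mul_zero, norm_zero, add_zero] at h3
  have h4 := norm_le_zero_iff.1 (nonpos_of_mul_nonpos_right h3 hc)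
  have h5 : ∀ j, j < 1 → ψ j = 0 := fun j hj => by
    rw [← hφ2 j hj, ← L2Z.restrict_apply_mem φ (Set.mem_Iio.2 hj), h4]
    rfl
  ext i
  fin_cases i <;> simp [h5]

end SolutionSpace

/-! ### Growth of left solutions, decay of right solutions, domination. -/

section Domination

variable {Ω : Type*} [MetricSpace Ω] {T : Ω ≃ₜ Ω} {a : C(Ω, ℂ)} {b : C(Ω, ℝ)} {E : ℂ} {c : ℝ}

theorem norm_pair_le (p q : ℂ) : ‖!₂[p, q]‖ ≤ ‖p‖ + ‖q‖ := by
  rw [EuclideanSpace.norm_eq, Fin.sum_univ_two]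
  refine Real.sqrt_le_iff.2 ⟨by positivity, ?_⟩
  simp
  nlinarith [norm_nonneg p, norm_nonneg q]

theorem norm_add_norm_le (p q : ℂ) : ‖p‖ + ‖q‖ ≤ 2 * ‖!₂[p, q]‖ := by
  have h0 := EuclideanSpace.norm_sq_eq !₂[p, q]
  simp only [Fin.sum_univ_two, Matrix.cons_val_zero, Matrix.cons_val_one] at h0
  have h1 : ‖p‖ ≤ ‖!₂[p, q]‖ := by
    refine le_of_sq_le_sq ?_ (norm_nonneg _)
    nlinarith [sq_nonneg ‖q‖]
  have h2 : ‖q‖ ≤ ‖!₂[p, q]‖ := by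
    refine le_of_sq_le_sq ?_ (norm_nonneg _)
    nlinarith [sq_nonneg ‖p‖]
  linarith

/-- Continuation to the right would divide by `a`; multiplying the past by `a` at each step instead
collects the product. -/
theorem exists_iterated_extension {ω : Ω} {ψ : L2Z}
    (hψ : ∀ j, j < 0 → jacobiDiff T a b E ω ψ j = 0) (n : ℕ) :
    ∃ y : L2Z, (∀ j : ℤ, j < n → jacobiDiff T a b E ω y j = 0) ∧
      cocycleIter T a b E n ω !₂[ψ 0, ψ (-1)] = !₂[y n, y (n - 1)] ∧
      ∀ j, j ≤ 0 → y j = (∏ j ∈ Finset.range n, a ((T ^ (j : ℤ)) ω)) * ψ j := by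
  induction n with
  | zero => exact ⟨ψ, by simpa using hψ, by simp [cocycleIter_zero], by simp⟩
  | succ n ih =>
    obtain ⟨y, h1, h2, h3⟩ := ih
    obtain ⟨y', h1', h2', h3'⟩ := exists_extension h1
    refine ⟨y', fun j hj => h1' j (by push_cast at hj; omega), ?_, fun j hj => ?_⟩
    · rw [cocycleIter_succ, h2, h2']
      simp
    · rw [h3' j (by omega), h3 j hj, Finset.prod_range_succ]
      ring

theorem cocycleIter_mem_solutionSpace_Iio {ω : Ω} {u : EuclideanSpace ℂ (Fin 2)}
    (hu : u ∈ solutionSpace T a b E (Set.Iio 0) ω) (n : ℕ) :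
    cocycleIter T a b E n ω u ∈ solutionSpace T a b E (Set.Iio 0) ((T ^ (n : ℤ)) ω) := by
  induction n with
  | zero => simpa [cocycleIter_zero] using hu
  | succ n ih =>
    rw [cocycleIter_succ, Nat.cast_succ, ← apply_zpow_apply]
    exact cocycleStep_mem_solutionSpace_Iio ih

variable [CompactSpace Ω]

/-- Apply the left tail bound to the iterated extension: the values at `0` and `-1` are the original
data times the product, and the boundary values at `n + 1` and `n` form the cocycle image. Using `n
+ 1` steps keeps index `0` inside the tail. -/
theorem norm_prod_mul_norm_le (hc : 0 < c) {ω : Ω}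
    (h : ∀ ψ, c * ‖ψ‖ ≤ ‖jacobiSub T a b E ω ψ‖) {u : EuclideanSpace ℂ (Fin 2)}
    (hu : u ∈ solutionSpace T a b E (Set.Iio 0) ω) (n : ℕ) :
    ‖∏ j ∈ Finset.range (n + 1), a ((T ^ (j : ℤ)) ω)‖ * ‖u‖ ≤
      4 * (‖a‖ / c) * ‖cocycleIter T a b E (n + 1) ω u‖ := by
  obtain ⟨ψ, rfl, hψ⟩ := hu
  obtain ⟨y, h1, h2, h3⟩ := exists_iterated_extension hψ (n + 1)
  have h4 := mul_norm_restrict_Iio_le h h1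
  have ha : ∀ ω, ‖a ω‖ ≤ ‖a‖ := a.norm_coe_le_norm
  have h5 : ‖L2Z.restrict (Set.Iio ((n + 1 : ℕ) : ℤ)) y‖ ≤
      2 * (‖a‖ / c) * ‖cocycleIter T a b E (n + 1) ω !₂[ψ 0, ψ (-1)]‖ := by
    rw [h2, mul_div_assoc', div_mul_eq_mul_div, le_div_iff₀' hc]
    refine h4.trans ?_
    rw [norm_mul, norm_mul, ← mul_add]
    calc _ ≤ ‖a‖ * (2 * ‖!₂[y (n + 1 : ℕ), y ((n + 1 : ℕ) - 1)]‖) :=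
          mul_le_mul (ha _) (norm_add_norm_le _ _) (by positivity) (norm_nonneg _)
      _ = _ := by ring
  have h6 : ∀ j : ℤ, j ≤ 0 → ‖y j‖ ≤ ‖L2Z.restrict (Set.Iio ((n + 1 : ℕ) : ℤ)) y‖ := fun j hj => by
    rw [← L2Z.restrict_apply_mem y (Set.mem_Iio.2 (show j < ((n + 1 : ℕ) : ℤ) by omega))]
    exact L2Z.norm_apply_le _ _
  calc ‖∏ j ∈ Finset.range (n + 1), a ((T ^ (j : ℤ)) ω)‖ * ‖!₂[ψ 0, ψ (-1)]‖
      ≤ ‖∏ j ∈ Finset.range (n + 1), a ((T ^ (j : ℤ)) ω)‖ * (‖ψ 0‖ + ‖ψ (-1)‖) := by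
        gcongr
        exact norm_pair_le _ _
    _ = ‖y 0‖ + ‖y (-1)‖ := by
        rw [h3 0 le_rfl, h3 (-1) (by omega), norm_mul, norm_mul]
        ring
    _ ≤ _ := by linarith [h6 0 le_rfl, h6 (-1) (by omega)]

theorem cocycleIter_ne_zero (hc : 0 < c) (h : ∀ ω ψ, c * ‖ψ‖ ≤ ‖jacobiSub T a b E ω ψ‖) {ω : Ω}
    {u : EuclideanSpace ℂ (Fin 2)} (hu : u ∈ solutionSpace T a b E (Set.Iio 0) ω) (h0 : u ≠ 0)
    (n : ℕ) : cocycleIter T a b E n ω u ≠ 0 := by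
  induction n with
  | zero => rwa [cocycleIter_zero]
  | succ n ih =>
    rw [cocycleIter_succ]
    exact fun h1 => ih (eq_zero_of_cocycleStep_eq_zero hc (h _)
      (cocycleIter_mem_solutionSpace_Iio hu n) h1)

/-- Polynomial decay of square-summable solutions on the right half-line. -/
theorem mul_norm_add_norm_sq_le (hc : 0 < c) {ω : Ω}
    (h : ∀ ψ, c * ‖ψ‖ ≤ ‖jacobiSub T a b E ω ψ‖) {ψ : L2Z}
    (hψ : ∀ n, 0 ≤ n → jacobiDiff T a b E ω ψ n = 0) (N : ℕ) :
    N * (‖ψ (N + 1)‖ + ‖ψ N‖) ^ 2 ≤ 16 * (‖a‖ / c) ^ 4 * (‖ψ 0‖ + ‖ψ (-1)‖) ^ 2 := by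
  have ha : ∀ ω, ‖a ω‖ ≤ ‖a‖ := a.norm_coe_le_norm
  have htail : ∀ m : ℤ, 0 ≤ m → ‖L2Z.restrict (Set.Ici m) ψ‖ ≤
      ‖a‖ / c * (‖ψ m‖ + ‖ψ (m - 1)‖) := by
    intro m hm
    rw [div_mul_eq_mul_div, le_div_iff₀' hc]
    refine (mul_norm_restrict_Ici_le h fun n hn => hψ n (hm.trans hn)).trans ?_
    rw [norm_mul, norm_mul, ← mul_add]
    exact mul_le_mul_of_nonneg_right (ha _) (by positivity)
  have hle : ∀ m n : ℤ, m ≤ n → ‖ψ n‖ ≤ ‖L2Z.restrict (Set.Ici m) ψ‖ := fun m n hmn => by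
    rw [← L2Z.restrict_apply_mem ψ (Set.mem_Ici.2 hmn)]
    exact L2Z.norm_apply_le _ _
  have hC : 0 ≤ ‖a‖ / c := by positivity
  set C := ‖a‖ / c
  -- The values at `N` and `N + 1` lie in every tail `[m + 1, ∞)` with `m < N`. Summing these `N`
  -- bounds and using the tail bound at `0` once more yields decay of order `1 / N`.
  have h1 : ∀ m ∈ Finset.range N, (‖ψ (N + 1)‖ + ‖ψ N‖) ^ 2 ≤
      4 * C ^ 2 * (2 * (‖ψ ((m : ℤ) + 1)‖ ^ 2 + ‖ψ m‖ ^ 2)) := by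
    intro m hm
    have hm := Finset.mem_range.1 hm
    have e1 := htail (m + 1) (by omega)
    have e2 := hle (m + 1) (N + 1) (by omega)
    have e3 := hle (m + 1) N (by omega)
    rw [add_sub_cancel_right] at e1
    calc (‖ψ (N + 1)‖ + ‖ψ N‖) ^ 2 ≤ (2 * (C * (‖ψ ((m : ℤ) + 1)‖ + ‖ψ m‖))) ^ 2 := by
          gcongr
          linarith
      _ = 4 * C ^ 2 * (‖ψ ((m : ℤ) + 1)‖ + ‖ψ m‖) ^ 2 := by ring
      _ ≤ _ := by
          gcongr
          nlinarith [sq_nonneg (‖ψ ((m : ℤ) + 1)‖ - ‖ψ m‖)]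
  have h2 : ∀ i : ℤ, 0 ≤ i → ∑ m ∈ Finset.range N, ‖ψ ((m : ℤ) + i)‖ ^ 2 ≤
      ‖L2Z.restrict (Set.Ici 0) ψ‖ ^ 2 := by
    intro i hi
    have hinj : Function.Injective fun m : ℕ => (m : ℤ) + i := fun m n hmn => by
      simpa using hmn
    have e1 : ∑ m ∈ Finset.range N, ‖ψ ((m : ℤ) + i)‖ ^ 2 =
        ∑ n ∈ (Finset.range N).map ⟨_, hinj⟩, ‖L2Z.restrict (Set.Ici 0) ψ n‖ ^ 2 := by
      rw [Finset.sum_map]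
      refine Finset.sum_congr rfl fun m _ => ?_
      rw [L2Z.restrict_apply_mem]
      · rfl
      · simp only [Function.Embedding.coeFn_mk, Set.mem_Ici]
        positivity
    rw [e1, L2Z.norm_sq_eq_tsum]
    exact (L2Z.summable_norm_sq _).sum_le_tsum _ fun _ _ => by positivity
  have h3 := htail 0 le_rfl
  rw [zero_sub] at h3
  have h4 := h2 0 le_rfl
  simp only [add_zero] at h4
  calc N * (‖ψ (N + 1)‖ + ‖ψ N‖) ^ 2
      = ∑ _m ∈ Finset.range N, (‖ψ (N + 1)‖ + ‖ψ N‖) ^ 2 := by simp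
    _ ≤ ∑ m ∈ Finset.range N, 4 * C ^ 2 * (2 * (‖ψ ((m : ℤ) + 1)‖ ^ 2 + ‖ψ m‖ ^ 2)) :=
        Finset.sum_le_sum h1
    _ = 8 * C ^ 2 * (∑ m ∈ Finset.range N, ‖ψ ((m : ℤ) + 1)‖ ^ 2 +
          ∑ m ∈ Finset.range N, ‖ψ m‖ ^ 2) := by
        rw [← Finset.mul_sum, ← Finset.mul_sum, Finset.sum_add_distrib]
        ring
    _ ≤ 8 * C ^ 2 * (‖L2Z.restrict (Set.Ici 0) ψ‖ ^ 2 + ‖L2Z.restrict (Set.Ici 0) ψ‖ ^ 2) := by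
        gcongr
        exact h2 1 (by norm_num)
    _ ≤ 8 * C ^ 2 * ((C * (‖ψ 0‖ + ‖ψ (-1)‖)) ^ 2 + (C * (‖ψ 0‖ + ‖ψ (-1)‖)) ^ 2) := by gcongr
    _ = _ := by ring

theorem exists_domination (hc : 0 < c) (h : ∀ ω ψ, c * ‖ψ‖ ≤ ‖jacobiSub T a b E ω ψ‖) :
    ∃ N : ℕ, 0 < N ∧ ∀ ω, ∀ u ∈ solutionSpace T a b E (Set.Iio 0) ω,
      ∀ s ∈ solutionSpace T a b E (Set.Ici 0) ω, ‖u‖ = 1 → ‖s‖ = 1 →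
        2 * ‖cocycleIter T a b E N ω s‖ < ‖cocycleIter T a b E N ω u‖ := by
  -- With `C = ‖a‖ / c`, decay gives `N * S² ≤ 64 C⁴`, and `8 C S < 1` is needed: `64 C² * 64 C⁴ =
  -- 4096 C⁶`.
  obtain ⟨N, hN⟩ := exists_nat_gt (4096 * (‖a‖ / c) ^ 6)
  refine ⟨N + 1, N.succ_pos, fun ω u hu s hs hu1 hs1 => ?_⟩
  have hu2 := norm_prod_mul_norm_le hc (h ω) hu N
  have hu3 := norm_pos_iff.2 (cocycleIter_ne_zero hc h hu
    (norm_ne_zero_iff.1 (by rw [hu1]; exact one_ne_zero)) (N + 1))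
  obtain ⟨ψ, rfl, hψ⟩ := hs
  have hs2 := mul_norm_add_norm_sq_le hc (h ω) hψ N
  have hs3 := norm_add_norm_le (ψ 0) (ψ (-1))
  rw [cocycleIter_pair_eq _ _ _ _ _ _ _ hψ, norm_smul]
  rw [hs1, mul_one] at hs3
  rw [hu1, mul_one] at hu2
  have hs4 := norm_pair_le (ψ (N + 1)) (ψ N)
  have e1 : ((N + 1 : ℕ) : ℤ) = N + 1 := by push_cast; rfl
  rw [e1, add_sub_cancel_right]
  have hC : 0 ≤ ‖a‖ / c := by positivity
  set C := ‖a‖ / c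
  set p := ‖∏ j ∈ Finset.range (N + 1), a ((T ^ (j : ℤ)) ω)‖
  set S := ‖ψ (N + 1)‖ + ‖ψ N‖
  set x := ‖!₂[ψ (N + 1), ψ N]‖
  set y := ‖cocycleIter T a b E (N + 1) ω u‖
  -- If `a` vanishes along the segment, the stable image is zero and injectivity on the left
  -- solutions suffices. Otherwise the common factor `p` of the two estimates cancels.
  rcases (show 0 ≤ p from norm_nonneg _).eq_or_lt with hp | hp
  · rw [← hp]
    simpa using hu3
  have hC' : 0 < C := by
    by_contra hC'
    have : C = 0 := le_antisymm (not_lt.1 hC') hC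
    rw [this] at hu2
    linarith
  have hS : 8 * C * S < 1 := by
    have h5 : (‖ψ 0‖ + ‖ψ (-1)‖) ^ 2 ≤ 2 ^ 2 := pow_le_pow_left₀ (by positivity) hs3 2
    have h6 : (N : ℝ) * S ^ 2 ≤ 64 * C ^ 4 := by
      refine hs2.trans ?_
      nlinarith [pow_nonneg hC 4]
    refine lt_of_pow_lt_pow_left₀ 2 zero_le_one ?_
    have hN0 : 0 < (N : ℝ) := lt_of_le_of_lt (by positivity) hN
    refine lt_of_mul_lt_mul_left ?_ hN0.le
    calc (N : ℝ) * (8 * C * S) ^ 2 = 64 * C ^ 2 * (N * S ^ 2) := by ring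
      _ ≤ 64 * C ^ 2 * (64 * C ^ 4) := by gcongr
      _ = 4096 * C ^ 6 := by ring
      _ < N * 1 ^ 2 := by simpa using hN
  refine lt_of_mul_lt_mul_left ?_ (show 0 ≤ 4 * C by positivity)
  calc 4 * C * (2 * (p * x)) ≤ 4 * C * (2 * (p * S)) := by gcongr
    _ = p * (8 * C * S) := by ring
    _ < p * 1 := by gcongr
    _ ≤ 4 * C * y := by linarith

end Domination

/-! ### Continuous line fields as maps to `ℂP¹`. -/

section LineField

open Classical in
/-- The point of `ℂP¹` determined by a vector of `ℂ²`. -/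
noncomputable def toLine (v : EuclideanSpace ℂ (Fin 2)) : OnePoint ℂ :=
  if v 0 = 0 then OnePoint.infty else ((v 1 / v 0 : ℂ) : OnePoint ℂ)

theorem mem_line_toLine (v : EuclideanSpace ℂ (Fin 2)) : v ∈ line (toLine v) := by
  by_cases h : v 0 = 0
  · rw [toLine, if_pos h, mem_line_infty_iff, h]
  · rw [toLine, if_neg h, mem_line_coe_iff, div_mul_cancel₀ _ h]

theorem toLine_eq_of_cross_eq_zero {v w : EuclideanSpace ℂ (Fin 2)} (hv : v ≠ 0) (hw : w ≠ 0)
    (h : cross v w = 0) : toLine v = toLine w := by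
  have key : ∀ {v w : EuclideanSpace ℂ (Fin 2)}, v ≠ 0 → cross v w = 0 → v 0 = 0 → w 0 = 0 := by
    intro v w hv h h0
    have h1 : v 1 ≠ 0 := fun h1 => hv (by ext i; fin_cases i <;> simp [h0, h1])
    simpa [cross, h0, h1] using h
  by_cases h0 : v 0 = 0
  · rw [toLine, toLine, if_pos h0, if_pos (key hv h h0)]
  · have h' : cross w v = 0 := by
      rw [cross] at h ⊢
      linear_combination -h
    have h1 : w 0 ≠ 0 := fun h1 => h0 (key hw h' h1)
    rw [toLine, toLine, if_neg h0, if_neg h1]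
    congr 1
    rw [div_eq_div_iff h0 h1]
    rw [cross] at h
    linear_combination -h

theorem continuousAt_toLine {v : EuclideanSpace ℂ (Fin 2)} (hv : v ≠ 0) :
    ContinuousAt toLine v := by
  have c0 : Continuous fun w : EuclideanSpace ℂ (Fin 2) => w 0 := by fun_prop
  have c1 : Continuous fun w : EuclideanSpace ℂ (Fin 2) => w 1 := by fun_prop
  by_cases h0 : v 0 = 0
  · have h1 : v 1 ≠ 0 := fun h1 => hv (by ext i; fin_cases i <;> simp [h0, h1])
    rw [ContinuousAt, toLine, if_pos h0]
    intro U hU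
    rw [OnePoint.nhds_infty_eq, mem_sup, mem_map, coclosedCompact_eq_cocompact] at hU
    obtain ⟨hU1, hU2⟩ := hU
    rw [← Metric.cobounded_eq_cocompact, ← comap_norm_atTop, mem_comap] at hU1
    obtain ⟨V, hV, hVU⟩ := hU1
    obtain ⟨R, hR⟩ := mem_atTop_sets.1 hV
    have hcont : Continuous fun w : EuclideanSpace ℂ (Fin 2) => ‖w 1‖ - R * ‖w 0‖ :=
      c1.norm.sub (continuous_const.mul c0.norm)
    -- The condition that the slope exceeds `R` in modulus, written without division so that it is
    -- open at `w 0 = 0`.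
    have hev : ∀ᶠ w in 𝓝 v, 0 < ‖w 1‖ - R * ‖w 0‖ :=
      hcont.continuousAt.eventually (lt_mem_nhds (by simpa [h0] using h1))
    rw [mem_map]
    filter_upwards [hev] with w hw
    by_cases hw0 : w 0 = 0
    · rw [Set.mem_preimage, toLine, if_pos hw0]
      exact hU2
    · rw [Set.mem_preimage, toLine, if_neg hw0]
      refine hVU (hR _ ?_)
      rw [norm_div, le_div_iff₀ (norm_pos_iff.2 hw0)]
      linarith
  · have hev : ∀ᶠ w in 𝓝 v, w 0 ≠ 0 := c0.continuousAt.eventually (isOpen_ne.mem_nhds h0)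
    have hc : ContinuousAt (fun w : EuclideanSpace ℂ (Fin 2) =>
        ((w 1 / w 0 : ℂ) : OnePoint ℂ)) v :=
      OnePoint.continuous_coe.continuousAt.comp (c1.continuousAt.div c0.continuousAt h0)
    refine hc.congr ?_
    filter_upwards [hev] with w hw
    rw [toLine, if_neg hw]

/-- A field of lines with enough continuous sections is given by a continuous map to `ℂP¹`. -/
theorem exists_continuous_line_eq {X : Type*} [TopologicalSpace X]
    (L : X → Submodule ℂ (EuclideanSpace ℂ (Fin 2)))
    (h1 : ∀ x, ∀ v ∈ L x, ∀ w ∈ L x, cross v w = 0)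
    (h2 : ∀ x, ∃ σ : X → EuclideanSpace ℂ (Fin 2), Continuous σ ∧ (∀ y, σ y ∈ L y) ∧ σ x ≠ 0) :
    ∃ Z : X → OnePoint ℂ, Continuous Z ∧ ∀ x, line (Z x) = L x := by
  choose σ hσ hL h0 using h2
  refine ⟨fun x => toLine (σ x x), continuous_iff_continuousAt.2 fun x => ?_, fun x => ?_⟩
  · have hc : ContinuousAt (fun y => toLine (σ x y)) x :=
      (continuousAt_toLine (h0 x)).comp (hσ x).continuousAt
    refine hc.congr ?_
    filter_upwards [(hσ x).continuousAt.eventually (isOpen_ne.mem_nhds (h0 x))] with y hy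
    exact toLine_eq_of_cross_eq_zero hy (h0 y) (h1 y _ (hL x y) _ (hL y y))
  · ext w
    constructor
    · intro hw
      have h := cross_eq_zero_of_mem_line (mem_line_toLine (σ x x)) hw
      have hsmul : ∃ z : ℂ, w = z • σ x x := by
        by_cases hz : σ x x 0 = 0
        · have hz1 : σ x x 1 ≠ 0 := fun hz1 =>
            h0 x (by ext i; fin_cases i <;> simp [hz, hz1])
          have hw0 : w 0 = 0 := by simpa [cross, hz, hz1] using h
          refine ⟨w 1 / σ x x 1, ?_⟩
          ext i
          fin_cases i <;> simp [hz, hw0, hz1]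
        · refine ⟨w 0 / σ x x 0, ?_⟩
          rw [cross] at h
          ext i
          fin_cases i
          · simp [hz]
          · simp only [Fin.mk_one, PiLp.smul_apply, smul_eq_mul]
            field_simp
            linear_combination h
      obtain ⟨z, rfl⟩ := hsmul
      exact Submodule.smul_mem _ _ (hL x x)
    · exact fun hw => mem_line_of_cross_eq_zero (mem_line_toLine _) (h0 x) (h1 x _ (hL x x) _ hw)

end LineField

/-! ### Assembling the splitting. -/

section Splitting

variable {Ω : Type*} [MetricSpace Ω] [CompactSpace Ω] {T : Ω ≃ₜ Ω} {a : C(Ω, ℂ)} {b : C(Ω, ℝ)}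
  {E : ℂ} {c : ℝ}

/-- A uniform lower bound for `J_ω - E` yields a dominated splitting. -/
theorem nonempty_jacobiSplitting (hc : 0 < c)
    (h : ∀ ω ψ, c * ‖ψ‖ ≤ ‖jacobiSub T a b E ω ψ‖) : Nonempty (JacobiSplitting T a b E) := by
  have hcs := fun ω v (hv : v ∈ solutionSpace T a b E (Set.Ici 0) ω) w
    (hw : w ∈ solutionSpace T a b E (Set.Ici 0) ω) =>
    cross_eq_zero_of_mem_solutionSpace_Ici hc (h ω) hv hw
  have hcu := fun ω v (hv : v ∈ solutionSpace T a b E (Set.Iio 0) ω) w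
    (hw : w ∈ solutionSpace T a b E (Set.Iio 0) ω) =>
    cross_eq_zero_of_mem_solutionSpace_Iio hc (h ω) hv hw
  choose σ hσ hσs hσu using exists_continuous_splitting hc h
  have hcross : cross !₂[1, 0] !₂[0, 1] ≠ 0 := by simp [cross]
  obtain ⟨Es, hEs, hEs'⟩ := exists_continuous_line_eq _ hcs fun ω => by
    by_contra! hcon
    -- If every continuous section of right data vanished at `ω`, every vector would be left data,
    -- which is impossible in a space where `cross` vanishes.
    have hmem : ∀ v, v ∈ solutionSpace T a b E (Set.Iio 0) ω := fun v => by
      simpa [hcon (σ v) (hσ v) (hσs v)] using hσu v ω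
    exact hcross (hcu ω _ (hmem _) _ (hmem _))
  obtain ⟨Eu, hEu, hEu'⟩ := exists_continuous_line_eq _ hcu fun ω => by
    by_contra! hcon
    have hmem : ∀ v, v ∈ solutionSpace T a b E (Set.Ici 0) ω := fun v => by
      have h1 := hcon (fun ω => v - σ v ω) (continuous_const.sub (hσ v)) (hσu v)
      rw [sub_eq_zero.1 h1]
      exact hσs v ω
    exact hcross (hcs ω _ (hmem _) _ (hmem _))
  obtain ⟨N, hN, hdom⟩ := exists_domination hc h
  exact ⟨{
    stable := Es
    unstable := Eu
    continuous_stable := hEs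
    continuous_unstable := hEu
    step_stable := fun ω v hv => by
      rw [hEs'] at hv ⊢
      exact cocycleStep_mem_solutionSpace_Ici hv
    step_unstable := fun ω v hv => by
      rw [hEu'] at hv ⊢
      exact cocycleStep_mem_solutionSpace_Iio hv
    steps := N
    steps_pos := hN
    rate := 2
    one_lt_rate := one_lt_two
    dominates := fun ω u hu s hs => hdom ω u (hEu' ω ▸ hu) s (hEs' ω ▸ hs) }⟩

end Splitting

end JacobiJohnson

theorem theorem1p10 {Ω : Type*} [MetricSpace Ω] [CompactSpace Ω] (T : Ω ≃ₜ Ω)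
    (a : C(Ω, ℂ)) (b : C(Ω, ℝ)) (ω₀ : Ω)
    (hω₀ : closure (Set.range fun n : ℤ => (T ^ n) ω₀) = Set.univ) :
    resolventSet ℂ (JacobiJohnson.jacobiOperator T a b ω₀) =
      {E : ℂ | JacobiJohnson.HasDominatedSplitting T (JacobiJohnson.jacobiCocycle T a b E)} := by
  ext E
  rw [Set.mem_ofPred_eq, JacobiJohnson.hasDominatedSplitting_jacobiCocycle_iff,
    JacobiJohnson.mem_resolventSet_jacobiOperator_iff]
  constructor
  · rintro ⟨c, hc, h⟩
    exact JacobiJohnson.nonempty_jacobiSplitting hc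
      (JacobiJohnson.forall_mul_norm_le_of_dense hω₀ h)
  · rintro ⟨D⟩
    exact D.exists_mul_norm_le ω₀
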